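/- \textbf{Theorem (Transformer PPD approximation).} \emph{Setting.} Let $\kappa$ be a positive semidefinite kernel on $\mathbb R^d$ and $\sigma>0$. Consider the Gaussian process regression model $y_i=\phi(x_i)+\epsilon_i$ with $\phi\sim GP(0,\kappa)$ and $\epsilon_i\overset{iid}{\sim}\mathcal N(0,\sigma^2)$. For a context $Z^{(0)}$ consisting of $n\ge1$ training pairs $(X,Y)$ and a query $x=x_{n+1}$, let $G=(\kappa(x_i,x_j))_{i,j\le n}$ and $k_x=(\kappa(x_i,x))_{i\le n}$, and let $p_n(\cdot\mid Z^{(0)})$ be the posterior predictive density of the label at $x$; it is the density of $\mathcal N(\mu,\tau)$ with $\mu=k_x^\top(G+\sigma^2I)^{-1}Y$ and $\tau=\kappa(x,x)+\sigma^2-k_x^\top(G+\sigma^2I)^{-1}k_x$. Let $\lambda_1(G)\ge\lambda_n(G)$ be the extreme eigenvalues of $G$. Fix $a<b$, a compact set $\mathcal K\subset\mathbb R\times(0,\infty)$, and a continuous activation $\mathrm{act}:\mathbb R\to\mathbb R$ that is not a polynomial. Let $\psi(\mu,\tau)=(\mu/\tau,-1/(2\tau))$, and for $C\ge1$ let $\gamma_1=a<\dots<\gamma_{C+1}=b$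 be the equidistant grid, with midpoints $\xi_c=(\gamma_c+\gamma_{c+1})/2$, and let $\Xi\in\mathbb R^{C\times2}$ have rows $(\xi_c,\xi_c^2)$. \emph{Attention block.} Tokens live in $\mathbb R^{d+4}$; the input is $Z^{(0)}=\begin{bmatrix}X^\top&x_{n+1}\\Y^\top&1\\0_{3\times n}&0_3\end{bmatrix}$. With $\kappa$ also denoting a positive semidefinite kernel on $\mathbb R^{d+4}$ such that $\kappa((x,0_4),(x',0_4))=\kappa(x,x')$, put $[\mathrm{Attn}_M(Z;V,K,Q)]_{:,j}=\sum_{i}\kappa(Kz_i,Qz_j)M_{ij}Vz_i$, and $Z^{(1)}=Z^{(0)}+\mathrm{Attn}_{M^{(0)}}(Z^{(0)};V^{(0)},K^{(0)},Q^{(0)})$, $Z^{(l+1)}=Z^{(l)}+\mathrm{Attn}_{M}(Z^{(l)};V^{(l)},K^{(l)},Q^{(l)})+S^{(l)}Z^{(l)}$ for $1\le l\le L-1$, where $M^{(0)}_{ij}=1_{\{i>n\}}$ and $M_{ij}=1_{\{i\le n\}}$. For a step size $\eta>0$ the weights are (unspecified entries being $0$) $K^{(l)}=Q^{(l)}=\mathrm{diag}(1_d,0_4)$;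 $V^{(0)}_{d+2,d+1}=1$; and for $l\ge1$, $V^{(l)}_{d+3,d+1}=V^{(l)}_{d+4,d+2}=\eta$, $V^{(l)}_{d+3,d+3}=V^{(l)}_{d+4,d+4}=-\eta$, $S^{(l)}_{d+3,d+3}=S^{(l)}_{d+4,d+4}=-\eta\sigma^2$. The moment readout is $W\in\mathbb R^{2\times(d+4)}$ with rows $(0_d,0,0,1,0)$ and $(0_d,\sigma^2,1,0,-1)$. \emph{Conclusion.} There is a constant $c>0$ such that for every $\delta_{\mathrm{MLP}}>0$ there is a one-hidden-layer MLP $\tilde\psi(\theta)=\tilde W_2\,\mathrm{act}(\tilde W_1\theta+\tilde h_1)+\tilde h_2$ with $\sup_{\theta\in\mathcal K}\|\psi(\theta)-\tilde\psi(\theta)\|_2\le\delta_{\mathrm{MLP}}$ such that, for all $\eta>0$, $L\ge1$ and $C\ge1$, the following holds for the transformer $\vartheta$ that consists of the $L$ attention layers above with step size $\eta$, followed by the MLP head with $W_1=\tilde W_1W$, $h_1=\tilde h_1$, $W_2=\Xi\tilde W_2$, $h_2=\Xi\tilde h_2$, that is, with logits $\boldsymbol\ell=\Xi\,\tilde\psi(W[Z^{(L)}]_{:,n+1})$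 and output density $$q_\vartheta(y\mid Z^{(0)})=\sum_{c=1}^C\frac{\mathbf 1_{y\in(\gamma_c,\gamma_{c+1}]}}{(b-a)/C}\,\mathrm{softmax}(\boldsymbol\ell)_c .$$ For every $n\ge1$ and every context $Z^{(0)}$ of size $n$ with $(\mu,\tau)\in\mathcal K$ and $\eta(\lambda_1(G)+\sigma^2)<1$, the convergence factor $\rho=1-\eta(\lambda_n(G)+\sigma^2)$ lies in $(0,1)$, and $$\mathrm{TV}(p_n,q_\vartheta)\le c\Big(P\,e^{-(1-\rho)L}+\delta_{\mathrm{MLP}}+\frac1C+\varepsilon_{\mathrm{tail}}\Big),\qquad P=\frac{\|k_x\|_2\max(\|Y\|_2,\|k_x\|_2)}{\lambda_n(G)+\sigma^2},$$ where $\varepsilon_{\mathrm{tail}}=\mathbb P_{y\sim p_n(\cdot\mid Z^{(0)})}(y\notin(a,b])$ and $\mathrm{TV}(p,q)=\frac12\int|p-q|$. Here $c$ and $\tilde\psi$ do not depend on $\eta,L,C,n$ or the context, $c$ does not depend on $\delta_{\mathrm{MLP}}$, and $\vartheta$ does not depend on $n$ or the context. -/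

import Mathlib

open scoped Matrix

noncomputable section

namespace PFN

/-! ### Gaussian process regression -/

/-- A context of size `n` with its query point: training inputs `X`, training labels `Y`, and the
query input `xq`. -/
structure Context (d n : ℕ) where
  X : Fin n → Fin d → ℝ
  Y : Fin n → ℝ
  xq : Fin d → ℝ

/-- A (symmetric) positive semidefinite kernel: all its finite Gram matrices are positive
semidefinite. -/
def IsPSDKernel {E : Type*} (κ : E → E → ℝ) : Prop := (Matrix.of κ).PosSemidef

/-- The Gram matrix of a family of points. -/
def gram {E ι : Type*} (κ : E → E → ℝ) (x : ι → E) : Matrix ι ι ℝ :=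
  Matrix.of fun i j => κ (x i) (x j)

/-- Covariance matrix of the noisy labels `y_i = φ(x_i) + ε_i` with `φ ∼ GP(0, κ)` and
independent noise `ε_i ∼ N(0, σ²)`. -/
def labelCov {E ι : Type*} [DecidableEq ι] (κ : E → E → ℝ) (σ : ℝ) (x : ι → E) :
    Matrix ι ι ℝ :=
  gram κ x + σ ^ 2 • (1 : Matrix ι ι ℝ)

/-- Density at `v` of the centred normal distribution with (positive definite) covariance `S`. -/
def gaussianDensity {ι : Type*} [Fintype ι] [DecidableEq ι] (S : Matrix ι ι ℝ) (v : ι → ℝ) : ℝ :=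
  (Real.sqrt ((2 * Real.pi) ^ Fintype.card ι * S.det))⁻¹ * Real.exp (-(v ⬝ᵥ (S⁻¹ *ᵥ v)) / 2)

/-- Posterior predictive density of the label `y` at the query point, given the training labels:
the joint prior predictive density of all `n + 1` labels over that of the `n` training labels. -/
def ppdDensity {d n : ℕ} (κ : (Fin d → ℝ) → (Fin d → ℝ) → ℝ) (σ : ℝ) (Z : Context d n)
    (y : ℝ) : ℝ :=
  gaussianDensity (labelCov κ σ (Sum.elim Z.X fun _ : Unit => Z.xq)) (Sum.elim Z.Y fun _ => y) /
    gaussianDensity (labelCov κ σ Z.X) Z.Y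

/-- The vector `k_x = (κ(x_1, x), …, κ(x_n, x))`. -/
def kvec {d n : ℕ} (κ : (Fin d → ℝ) → (Fin d → ℝ) → ℝ) (Z : Context d n) : Fin n → ℝ :=
  fun i => κ (Z.X i) Z.xq

/-- Predictive mean `k_xᵀ (G + σ² I)⁻¹ Y`. -/
def ppdMean {d n : ℕ} (κ : (Fin d → ℝ) → (Fin d → ℝ) → ℝ) (σ : ℝ) (Z : Context d n) : ℝ :=
  kvec κ Z ⬝ᵥ ((labelCov κ σ Z.X)⁻¹ *ᵥ Z.Y)

/-- Predictive variance `κ(x, x) + σ² - k_xᵀ (G + σ² I)⁻¹ k_x`. -/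
def ppdVar {d n : ℕ} (κ : (Fin d → ℝ) → (Fin d → ℝ) → ℝ) (σ : ℝ) (Z : Context d n) : ℝ :=
  κ Z.xq Z.xq + σ ^ 2 - kvec κ Z ⬝ᵥ ((labelCov κ σ Z.X)⁻¹ *ᵥ kvec κ Z)

/-- The pair (mean, variance). -/
def moments {d n : ℕ} (κ : (Fin d → ℝ) → (Fin d → ℝ) → ℝ) (σ : ℝ) (Z : Context d n) :
    Fin 2 → ℝ :=
  ![ppdMean κ σ Z, ppdVar κ σ Z]

/-- Mass that the posterior predictive distribution puts outside `(a, b]`. -/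
def tailMass {d n : ℕ} (κ : (Fin d → ℝ) → (Fin d → ℝ) → ℝ) (σ : ℝ) (Z : Context d n)
    (a b : ℝ) : ℝ :=
  ∫ y in (Set.Ioc a b)ᶜ, ppdDensity κ σ Z y

/-- Total variation distance of two probability densities on the real line. -/
def tvDist (p q : ℝ → ℝ) : ℝ := (∫ y, |p y - q y|) / 2

/-! ### The posterior predictive distribution is normal -/

theorem labelCov_posDef {E ι : Type*} [Fintype ι] [DecidableEq ι] {κ : E → E → ℝ}
    (hκ : IsPSDKernel κ) {σ : ℝ} (hσ : 0 < σ) (x : ι → E) : (labelCov κ σ x).PosDef := by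
  have h1 : (gram κ x).PosSemidef := Matrix.PosSemidef.submatrix hκ x
  have h2 : (σ ^ 2 • (1 : Matrix ι ι ℝ)).PosDef := Matrix.PosDef.one.smul (by positivity)
  exact Matrix.PosDef.posSemidef_add h1 h2

theorem ppdDensity_eq {d n : ℕ} {κ : (Fin d → ℝ) → (Fin d → ℝ) → ℝ} (hκ : IsPSDKernel κ)
    {σ : ℝ} (hσ : 0 < σ) (Z : Context d n) :
    0 < ppdVar κ σ Z ∧
    ppdDensity κ σ Z = ProbabilityTheory.gaussianPDFReal (ppdMean κ σ Z)
      (ppdVar κ σ Z).toNNReal := by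
  set A := labelCov κ σ Z.X with hA
  set k := kvec κ Z with hk
  set μ := ppdMean κ σ Z with hμ
  set τ := ppdVar κ σ Z with hτ
  set S := labelCov κ σ (Sum.elim Z.X fun _ : Unit => Z.xq) with hS
  have hApd : A.PosDef := labelCov_posDef hκ hσ _
  have hSpd : S.PosDef := labelCov_posDef hκ hσ _
  have hsymm : ∀ u v, κ u v = κ v u := fun u v => by
    simpa using (hκ.1.apply v u)
  have hAu : IsUnit A.det := (Matrix.isUnit_iff_isUnit_det A).1 hApd.isUnit
  have hSu : IsUnit S.det := (Matrix.isUnit_iff_isUnit_det S).1 hSpd.isUnit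
  have hblock : S = Matrix.fromBlocks A (Matrix.of fun i (_ : Unit) => k i)
      (Matrix.of fun (_ : Unit) i => k i) (Matrix.of fun _ _ => κ Z.xq Z.xq + σ ^ 2) := by
    ext i j
    rcases i with i | i <;> rcases j with j | j <;>
      simp [hS, hA, hk, labelCov, gram, kvec, Matrix.one_apply, hsymm]
  have hdet : S.det = A.det * τ := by
    let _ : Invertible A := Matrix.invertibleOfIsUnitDet A hAu
    rw [hblock, Matrix.det_fromBlocks₁₁]
    congr 1
    rw [Matrix.invOf_eq_nonsing_inv, Matrix.det_unique, hτ, ppdVar]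
    simp only [Matrix.sub_apply, Matrix.of_apply, ← hk, ← hA]
    congr 1
    simp only [Matrix.mul_apply, dotProduct, Matrix.mulVec, Matrix.of_apply, Finset.sum_mul,
      Finset.mul_sum]
    rw [Finset.sum_comm]
    exact Finset.sum_congr rfl fun i _ => Finset.sum_congr rfl fun j _ => by ring
  have hτpos : 0 < τ := by
    have h1 := hSpd.det_pos
    rw [hdet] at h1
    exact (mul_pos_iff_of_pos_left hApd.det_pos).1 h1
  refine ⟨hτpos, funext fun y => ?_⟩
  set s := (y - μ) / τ with hs
  have hquad : Sum.elim Z.Y (fun _ : Unit => y) ⬝ᵥ (S⁻¹ *ᵥ Sum.elim Z.Y (fun _ => y)) =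
      Z.Y ⬝ᵥ (A⁻¹ *ᵥ Z.Y) + (y - μ) ^ 2 / τ := by
    have hAsymm : Z.Y ⬝ᵥ (A⁻¹ *ᵥ k) = μ := by
      have h3 : (A⁻¹)ᵀ = A⁻¹ := by simpa using hApd.inv.isHermitian.eq
      rw [hμ, ppdMean, ← hk, ← hA, dotProduct_comm, Matrix.dotProduct_mulVec k,
        ← Matrix.mulVec_transpose, h3]
    have hw : S⁻¹ *ᵥ Sum.elim Z.Y (fun _ => y) =
        Sum.elim (A⁻¹ *ᵥ Z.Y - s • (A⁻¹ *ᵥ k)) (fun _ => s) := by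
      have h4 : S *ᵥ Sum.elim (A⁻¹ *ᵥ Z.Y - s • (A⁻¹ *ᵥ k)) (fun _ => s) =
          Sum.elim Z.Y (fun _ => y) := by
        rw [hblock, Matrix.fromBlocks_mulVec]
        congr 1
        · simp only [Sum.elim_comp_inl, Sum.elim_comp_inr]
          rw [Matrix.mulVec_sub, Matrix.mulVec_smul, Matrix.mulVec_mulVec, Matrix.mulVec_mulVec,
            Matrix.mul_nonsing_inv _ hAu, Matrix.one_mulVec, Matrix.one_mulVec]
          ext i
          simp [Matrix.mulVec, dotProduct]
          ring
        · funext u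
          have e1 : (κ Z.xq Z.xq + σ ^ 2) = τ + k ⬝ᵥ (A⁻¹ *ᵥ k) := by
            rw [hτ, ppdVar, ← hk, ← hA]; ring
          have e2 : k ⬝ᵥ (A⁻¹ *ᵥ Z.Y) = μ := rfl
          have e3 : ((Matrix.of fun (_ : Unit) i => k i) *ᵥ
              (A⁻¹ *ᵥ Z.Y - s • (A⁻¹ *ᵥ k))) u = μ - s * (k ⬝ᵥ (A⁻¹ *ᵥ k)) := by
            change k ⬝ᵥ _ = _
            rw [dotProduct_sub, dotProduct_smul, e2, smul_eq_mul]
          simp only [Sum.elim_comp_inl, Sum.elim_comp_inr, Pi.add_apply, e3]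
          simp only [Matrix.mulVec, dotProduct, Matrix.of_apply, Finset.univ_unique,
            Finset.sum_singleton]
          change μ - s * (k ⬝ᵥ (A⁻¹ *ᵥ k)) + _ = _
          rw [e1, hs]
          field_simp
          ring
      rw [← h4, Matrix.mulVec_mulVec, Matrix.nonsing_inv_mul _ hSu, Matrix.one_mulVec]
    rw [hw, sumElim_dotProduct_sumElim, dotProduct_sub, dotProduct_smul, hAsymm]
    simp only [dotProduct, Finset.univ_unique, Finset.sum_singleton, smul_eq_mul, hs]
    field_simp
    ring
  have hAd := hApd.det_pos
  have h2pi : (0 : ℝ) < 2 * Real.pi := by positivity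
  rw [ppdDensity, ← hS, ← hA, gaussianDensity, gaussianDensity, hquad, hdet,
    ProbabilityTheory.gaussianPDFReal, Real.coe_toNNReal _ hτpos.le]
  have hsq : Real.sqrt ((2 * Real.pi) ^ Fintype.card (Fin n ⊕ Unit) * (A.det * τ)) =
      Real.sqrt ((2 * Real.pi) ^ Fintype.card (Fin n) * A.det) * Real.sqrt (2 * Real.pi * τ) := by
    rw [← Real.sqrt_mul (by positivity)]
    congr 1
    rw [Fintype.card_sum, Fintype.card_unit, pow_succ]
    ring
  have hexp : Real.exp (-(Z.Y ⬝ᵥ (A⁻¹ *ᵥ Z.Y) + (y - μ) ^ 2 / τ) / 2) =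
      Real.exp (-(Z.Y ⬝ᵥ (A⁻¹ *ᵥ Z.Y)) / 2) * Real.exp (-(y - μ) ^ 2 / (2 * τ)) := by
    rw [← Real.exp_add]
    congr 1
    field_simp
    ring
  have hpos1 : 0 < Real.sqrt ((2 * Real.pi) ^ Fintype.card (Fin n) * A.det) :=
    Real.sqrt_pos.2 (by positivity)
  have hpos2 : 0 < Real.sqrt (2 * Real.pi * τ) := Real.sqrt_pos.2 (by positivity)
  rw [hsq, hexp]
  field_simp

/-! ### Spectral quantities -/

/-- Largest eigenvalue of a real symmetric matrix. -/
def maxEigenvalue {n : ℕ} (A : Matrix (Fin n) (Fin n) ℝ) : ℝ := sSup (spectrum ℝ A)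

/-- Smallest eigenvalue of a real symmetric matrix. -/
def minEigenvalue {n : ℕ} (A : Matrix (Fin n) (Fin n) ℝ) : ℝ := sInf (spectrum ℝ A)

/-- Convergence factor `ρ = 1 - η (λ_n(G) + σ²)` of the Richardson iteration with step `η`. -/
def convFactor {d n : ℕ} (κ : (Fin d → ℝ) → (Fin d → ℝ) → ℝ) (σ η : ℝ) (Z : Context d n) : ℝ :=
  1 - η * (minEigenvalue (gram κ Z.X) + σ ^ 2)

/-- The prefactor `‖k_x‖ max(‖Y‖, ‖k_x‖) / (λ_n(G) + σ²)` (Euclidean norms) of the convergence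
rate of the Richardson iterations for the two moments. -/
def ratePrefactor {d n : ℕ} (κ : (Fin d → ℝ) → (Fin d → ℝ) → ℝ) (σ : ℝ) (Z : Context d n) : ℝ :=
  ‖WithLp.toLp 2 (kvec κ Z)‖ * max ‖WithLp.toLp 2 Z.Y‖ ‖WithLp.toLp 2 (kvec κ Z)‖ /
    (minEigenvalue (gram κ Z.X) + σ ^ 2)

/-! ### Transformer architecture -/

/-- Rows of a token: the `d` features, the label, and three work registers. -/
abbrev Row (d : ℕ) := Fin d ⊕ Fin 4

/-- Columns of the token matrix: the `n` context tokens, and the query token. -/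
abbrev Col (n : ℕ) := Fin n ⊕ Unit

/-- The input token matrix. The query token carries the constant `1` in its label row. -/
def inputTokens {d n : ℕ} (Z : Context d n) : Matrix (Row d) (Col n) ℝ :=
  Matrix.of fun r c =>
    match r, c with
    | Sum.inl k, Sum.inl i => Z.X i k
    | Sum.inl k, Sum.inr _ => Z.xq k
    | Sum.inr s, Sum.inl i => if s = 0 then Z.Y i else 0
    | Sum.inr s, Sum.inr _ => if s = 0 then 1 else 0

/-- Masked unnormalized kernel attention
`[Attn_{M,κ}(Z; V, K, Q)]_{:,j} = ∑ i, κ(K z_i, Q z_j) M_{ij} V z_i`. -/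
def attn {d n : ℕ} (κ : (Row d → ℝ) → (Row d → ℝ) → ℝ) (M : Matrix (Col n) (Col n) ℝ)
    (V K Q : Matrix (Row d) (Row d) ℝ) (Z : Matrix (Row d) (Col n) ℝ) :
    Matrix (Row d) (Col n) ℝ :=
  V * Z * Matrix.of fun i j => κ (K *ᵥ Z.col i) (Q *ᵥ Z.col j) * M i j

/-- Mask of the first layer: only the query token is attended to. -/
def queryMask (n : ℕ) : Matrix (Col n) (Col n) ℝ :=
  Matrix.of fun i _ => if i.isRight then 1 else 0

/-- Mask of the later layers: only the context tokens are attended to. -/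
def contextMask (n : ℕ) : Matrix (Col n) (Col n) ℝ :=
  Matrix.of fun i _ => if i.isLeft then 1 else 0

/-- Parameters of one self-attention block. -/
structure LayerParams (d : ℕ) where
  V : Matrix (Row d) (Row d) ℝ
  K : Matrix (Row d) (Row d) ℝ
  Q : Matrix (Row d) (Row d) ℝ
  S : Matrix (Row d) (Row d) ℝ

/-- Parameters of a one-hidden-layer perceptron of width `w`. -/
structure MLPParams (ι o : Type) (w : ℕ) where
  W₁ : Matrix (Fin w) ι ℝ
  h₁ : Fin w → ℝ
  W₂ : Matrix o (Fin w) ℝ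
  h₂ : o → ℝ

/-- `x ↦ W₂ act(W₁ x + h₁) + h₂`, with `act` applied entrywise. -/
def MLPParams.eval {ι o : Type} [Fintype ι] {w : ℕ} (N : MLPParams ι o w) (act : ℝ → ℝ)
    (x : ι → ℝ) : o → ℝ :=
  N.W₂ *ᵥ (fun i => act ((N.W₁ *ᵥ x + N.h₁) i)) + N.h₂

/-- Parameters of a transformer with `L` attention layers and an MLP head of width `w` with `C`
logits. -/
structure TransformerParams (d L w C : ℕ) where
  layers : Fin L → LayerParams d
  head : MLPParams (Row d) (Fin C) w

/-- The token matrix after `l` layers. The first layer has the query mask and no linear skip term;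
the later ones have the context mask. -/
def tokens {d n L : ℕ} (κ : (Row d → ℝ) → (Row d → ℝ) → ℝ) (layers : Fin L → LayerParams d)
    (Z : Context d n) : ℕ → Matrix (Row d) (Col n) ℝ
  | 0 => inputTokens Z
  | l + 1 =>
    let T := tokens κ layers Z l
    if h : l < L then
      let P := layers ⟨l, h⟩
      if l = 0 then T + attn κ (queryMask n) P.V P.K P.Q T
      else T + attn κ (contextMask n) P.V P.K P.Q T + P.S * T
    else T

/-- The logits: the MLP head applied to the query column after the last layer. -/
def TransformerParams.logits {d n L w C : ℕ} (ϑ : TransformerParams d L w C)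
    (κ : (Row d → ℝ) → (Row d → ℝ) → ℝ) (act : ℝ → ℝ) (Z : Context d n) : Fin C → ℝ :=
  ϑ.head.eval act ((tokens κ ϑ.layers Z L).col (Sum.inr ()))

/-! ### Binned densities -/

/-- Softmax. -/
def softmax {C : ℕ} (ℓ : Fin C → ℝ) (c : Fin C) : ℝ := Real.exp (ℓ c) / ∑ c', Real.exp (ℓ c')

/-- Grid point number `c` of the equidistant partition of `(a, b]` into `C` bins, starting with
`gridPoint a b C 0 = a`. -/
def gridPoint (a b : ℝ) (C c : ℕ) : ℝ := a + (b - a) * c / C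

/-- Midpoint of the bin `c`. -/
def midpt (a b : ℝ) (C : ℕ) (c : Fin C) : ℝ :=
  (gridPoint a b C c + gridPoint a b C (c + 1)) / 2

/-- The piecewise-constant density on `(a, b]` whose bin probabilities are the softmax of `ℓ`. -/
def binnedDensity (a b : ℝ) {C : ℕ} (ℓ : Fin C → ℝ) (y : ℝ) : ℝ :=
  ∑ c : Fin C, (Set.Ioc (gridPoint a b C c) (gridPoint a b C (c + 1))).indicator
    (fun _ => softmax ℓ c / (gridPoint a b C (c + 1) - gridPoint a b C c)) y

/-- The density output by the transformer. -/
def TransformerParams.density {d n L w C : ℕ} (ϑ : TransformerParams d L w C)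
    (κ : (Row d → ℝ) → (Row d → ℝ) → ℝ) (act : ℝ → ℝ) (a b : ℝ) (Z : Context d n) : ℝ → ℝ :=
  binnedDensity a b (ϑ.logits κ act Z)

/-! ### The construction -/

/-- The attention layers that compute the predictive moments. All of them have
`K = Q = diag(1_d, 0_4)`. The first one writes `k_x` into the first work register. The later ones
run the two Richardson iterations with step `η` in the last two registers. -/
def momentLayers (d L : ℕ) (σ η : ℝ) : Fin L → LayerParams d := fun l =>
  { K := Matrix.fromBlocks 1 0 0 0
    Q := Matrix.fromBlocks 1 0 0 0
    V :=
      if l.val = 0 then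
        Matrix.fromBlocks 0 0 0
          !![0, 0, 0, 0;
             1, 0, 0, 0;
             0, 0, 0, 0;
             0, 0, 0, 0]
      else
        Matrix.fromBlocks 0 0 0
          !![0, 0, 0, 0;
             0, 0, 0, 0;
             η, 0, -η, 0;
             0, η, 0, -η]
    S :=
      if l.val = 0 then 0
      else
        Matrix.fromBlocks 0 0 0
          !![0, 0, 0, 0;
             0, 0, 0, 0;
             0, 0, -(η * σ ^ 2), 0;
             0, 0, 0, -(η * σ ^ 2)] }

/-- The linear readout of the pair (mean, variance) from a token. -/
def momentReadout (d : ℕ) (σ : ℝ) : Matrix (Fin 2) (Row d) ℝ :=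
  Matrix.fromCols 0
    !![0, 0, 1, 0;
       σ ^ 2, 1, 0, -1]

/-- Natural parameter `ψ(μ, τ) = (μ / τ, -1 / (2 τ))` of the normal distribution `N(μ, τ)`. -/
def naturalParam (θ : Fin 2 → ℝ) : Fin 2 → ℝ := ![θ 0 / θ 1, -1 / (2 * θ 1)]

/-- The matrix `Ξ` whose rows are the sufficient statistics `(ξ_c, ξ_c²)` of the midpoints. -/
def midptStats (a b : ℝ) (C : ℕ) : Matrix (Fin C) (Fin 2) ℝ :=
  Matrix.of fun c => ![midpt a b C c, midpt a b C c ^ 2]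

/-- The MLP head `z ↦ Ξ ψ̃(W z)` made of the MLP `ψ̃`, a linear readout `W` before it, and a
matrix `Ξ` after it. -/
def MLPParams.sandwich {ι ι' o o' : Type} [Fintype ι] [Fintype o] {w : ℕ} (N : MLPParams ι o w)
    (W : Matrix ι ι' ℝ) (Ξ : Matrix o' o ℝ) : MLPParams ι' o' w where
  W₁ := N.W₁ * W
  h₁ := N.h₁
  W₂ := Ξ * N.W₂
  h₂ := Ξ *ᵥ N.h₂

end PFN

end

noncomputable section

namespace PFN

/-! ### Universal approximation -/

section UniversalApproximation

open Filter Topology MeasureTheory Polynomial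
open scoped ContDiff

/-! The attention layers solve two linear systems with matrix `G + σ² I`, right-hand sides `Y` and
`k_x`, by Richardson iteration, without ever storing an iterate `u`: a register of each token holds
the kernel sum `∑ κ(x_i, ·) u_i` at that token's input (`tokens_succ`). At the query this sum is
`k_x · u`, so a linear readout gives approximate mean and variance. In an eigenbasis of `G` every
error coefficient contracts at least by `ρ` per step (`abs_dotProduct_richardson_sub_le`), and `ρ ≤
e^{-(1-ρ)}`.

The normal log-density is, up to a constant, linear in `(y, y²)` with coefficients `naturalParam`.
Hence logits formed from an approximate natural parameter at bin midpoints are uniformly close to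
the log-density on `(a, b]`, with errors from the moments, the perceptron and the bin width
(`tvDist_gaussian_binnedDensity_le`). Uniformly close logits give a pointwise bound `e^{-2ε} p ≤ q`
on `(a, b]`, and since both densities have mass one, a one-sided bound suffices for total variation
(`tvDist_le_of_exp_mul_le`).

The perceptron exists by universal approximation (`ridgeSpan_topologicalClosure_eq_top`): mollify
the activation, differentiate ridge functions within the closed span to produce all products of
affine functions, and apply Stone–Weierstrass. It approximates on a neighbourhood of the given
compact set, because inexact moments may leave that set. If the moment error is too large for this
neighbourhood, the trivial bound `TV ≤ 1` is absorbed in the constant. -/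

theorem exists_polynomial_eq_of_iteratedDeriv_eq_zero (k : ℕ) {g : ℝ → ℝ}
    (hg : ContDiff ℝ k g) (h : ∀ x, iteratedDeriv k g x = 0) :
    ∃ p : ℝ[X], p.degree < k ∧ ∀ x, g x = p.eval x := by
  induction k generalizing g with
  | zero => exact ⟨0, by simp, fun x => by simpa using h x⟩
  | succ k ih =>
    have hg' : ContDiff ℝ k (deriv g) := by
      have := (contDiff_succ_iff_deriv (n := k)).1 (by exact_mod_cast hg)
      exact this.2.2
    have hgd : Differentiable ℝ g := hg.differentiable (by simp)
    obtain ⟨p, hp, hpe⟩ := ih hg' fun x => by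
      have := h x
      rwa [iteratedDeriv_succ'] at this
    -- Termwise antiderivative of `p`; it differs from `g` by a constant.
    set q : ℝ[X] := ∑ i ∈ Finset.range k, C (p.coeff i / (i + 1)) * X ^ (i + 1) with hq
    have hqd : derivative q = p := by
      ext i
      rw [coeff_derivative, hq, finsetSum_coeff]
      simp only [coeff_C_mul, coeff_X_pow, add_left_inj, mul_ite, mul_one, mul_zero,
        Finset.sum_ite_eq, Finset.mem_range]
      split_ifs with hi
      · field_simp
      · rw [zero_mul, coeff_eq_zero_of_degree_lt]
        exact hp.trans_le (by exact_mod_cast not_lt.1 hi)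
    have hqdeg : q.degree < (k + 1 : ℕ) := by
      refine (degree_sum_le _ _).trans_lt ((Finset.sup_lt_iff (WithBot.bot_lt_coe _)).2 ?_)
      intro i hi
      refine (degree_C_mul_X_pow_le _ _).trans_lt ?_
      exact_mod_cast Nat.succ_lt_succ (Finset.mem_range.1 hi)
    refine ⟨q + C (g 0 - q.eval 0), ?_, fun x => ?_⟩
    · refine (degree_add_le _ _).trans_lt (max_lt hqdeg (degree_C_le.trans_lt ?_))
      exact_mod_cast Nat.succ_pos k
    · have hd : ∀ y, HasDerivAt (fun y => g y - q.eval y) 0 y := fun y => by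
        have h1 := (hgd y).hasDerivAt.sub (q.hasDerivAt y)
        rwa [hqd, hpe, sub_self] at h1
      have := is_const_of_deriv_eq_zero (fun y => (hd y).differentiableAt)
        (fun y => (hd y).deriv) x 0
      simp only [eval_add, eval_C]
      linarith

/-- A pointwise limit of polynomial functions of bounded degree is a polynomial function. -/
theorem exists_polynomial_eq_of_tendsto {ι : Type*} {l : Filter ι} [l.NeBot] (k : ℕ)
    {g : ι → ℝ → ℝ} {f : ℝ → ℝ} (hg : ∀ i, ∃ p : ℝ[X], p.degree < k ∧ ∀ x, g i x = p.eval x)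
    (hf : ∀ x, Tendsto (fun i => g i x) l (𝓝 (f x))) : ∃ p : ℝ[X], ∀ x, f x = p.eval x := by
  have hinj : Set.InjOn (fun i : ℕ => (i : ℝ)) (Finset.range k : Finset ℕ) :=
    fun i _ j _ h => Nat.cast_injective h
  -- A polynomial of degree below `k` is a fixed linear combination of its values at `0, …, k-1`,
  -- and such a formula passes to pointwise limits.
  refine ⟨Lagrange.interpolate (Finset.range k) (fun i : ℕ => (i : ℝ)) fun i => f i,
    fun x => tendsto_nhds_unique (hf x) ?_⟩
  have h1 : ∀ i, g i x = (Lagrange.interpolate (Finset.range k) (fun j : ℕ => (j : ℝ))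
      fun j => g i j).eval x := fun i => by
    obtain ⟨p, hp, hpe⟩ := hg i
    rw [hpe, Lagrange.eq_interpolate_of_eval_eq (v := fun i : ℕ => (i : ℝ))
      (r := fun j => g i j) hinj (by simpa using hp) fun j _ => (hpe j).symm]
  simp_rw [h1, Lagrange.interpolate_apply, eval_finsetSum, eval_mul, eval_C]
  exact tendsto_finsetSum _ fun j _ => (hf j).mul_const _

/-! ### Ridge functions in `C(X, ℝ)` -/

variable {X : Type*} [TopologicalSpace X] [CompactSpace X]

/-- A closed subspace is itself complete, so the integral can be taken inside `V`; the inclusion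
into `E` commutes with it. -/
theorem integral_mem_of_isClosed {E α : Type*} [NormedAddCommGroup E] [NormedSpace ℝ E]
    [CompleteSpace E] [TopologicalSpace α] [MeasurableSpace α] [OpensMeasurableSpace α]
    [SecondCountableTopology α] {ν : Measure α} [IsFiniteMeasureOnCompacts ν]
    {V : Submodule ℝ E} (hV : IsClosed (V : Set E)) {f : α → E} (hf : Continuous f)
    (hc : HasCompactSupport f) (hm : ∀ t, f t ∈ V) : ∫ t, f t ∂ν ∈ V := by
  have : CompleteSpace V := hV.completeSpace_coe
  let F : α → V := fun t => ⟨f t, hm t⟩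
  have hF : Continuous F := hf.subtype_mk hm
  have hFc : HasCompactSupport F := hc.mono fun t ht h => ht (Subtype.ext h)
  have hi : Integrable F ν := hF.integrable_of_hasCompactSupport hFc
  have := V.subtypeL.integral_comp_comm hi
  change ∫ t, f t ∂ν = _ at this
  rw [this]
  exact (∫ t, F t ∂ν).2

/-- If a closed subspace of `C(X, ℝ)` contains `m * (g ∘ u)` for all `u ∈ U`, it contains the
directional derivatives `m * v * (g' ∘ u)`. -/
theorem mul_comp_deriv_mem {U V : Submodule ℝ C(X, ℝ)} (hV : IsClosed (V : Set C(X, ℝ)))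
    {g g' : C(ℝ, ℝ)} (hg : ∀ x, HasDerivAt g (g' x) x) {m : C(X, ℝ)}
    (h : ∀ u ∈ U, m * g.comp u ∈ V) {u v : C(X, ℝ)} (hu : u ∈ U) (hv : v ∈ U) :
    m * v * g'.comp u ∈ V := by
  let Γ : C(ℝ, C(X, ℝ)) := ContinuousMap.curry
    ⟨fun z : ℝ × X => m z.2 * v z.2 * g' (u z.2 + z.1 * v z.2), by fun_prop⟩
  have hΓ : ∀ s x, Γ s x = m x * v x * g' (u x + s * v x) := fun s x => rfl
  -- The difference quotients of `s ↦ m * g.comp (u + s • v)` lie in `V`. Writing the increments as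
  -- integrals of the continuous curve `Γ` in `C(X, ℝ)` makes them converge in sup norm, without a
  -- separate uniform estimate.
  have hFTC : ∀ s : ℝ, ∫ t in (0 : ℝ)..s, Γ t = m * g.comp (u + s • v) - m * g.comp u := by
    intro s
    ext x
    have h1 := (ContinuousMap.evalCLM ℝ x).intervalIntegral_comp_comm
      (Γ.continuous.intervalIntegrable (μ := volume) 0 s)
    change _ = (∫ t in (0 : ℝ)..s, Γ t) x at h1
    rw [← h1]
    change ∫ t in (0 : ℝ)..s, Γ t x = _
    have h2 : ∀ t ∈ Set.uIcc 0 s, HasDerivAt (fun t => m x * g (u x + t * v x)) (Γ t x) t := by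
      intro t _
      have h3 : HasDerivAt (fun t : ℝ => u x + t * v x) (v x) t := by
        simpa using ((hasDerivAt_id t).mul_const (v x)).const_add (u x)
      have h4 := ((hg _).comp t h3).const_mul (m x)
      rw [hΓ, show m x * v x * g' (u x + t * v x) = m x * (g' (u x + t * v x) * v x) by ring]
      exact h4
    rw [intervalIntegral.integral_eq_sub_of_hasDerivAt h2
      (Continuous.intervalIntegrable (by simp_rw [hΓ]; fun_prop) _ _)]
    simp
  have hd : HasDerivAt (fun s : ℝ => ∫ t in (0 : ℝ)..s, Γ t) (Γ 0) 0 :=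
    intervalIntegral.integral_hasDerivAt_right (by simp)
      (Γ.continuous.stronglyMeasurableAtFilter _ _) Γ.continuous.continuousAt
  have h0 : Γ 0 = m * v * g'.comp u := by
    ext x
    simp [hΓ]
  rw [← h0]
  refine hV.mem_of_tendsto (hasDerivAt_iff_tendsto_slope.1 hd) (Eventually.of_forall fun s => ?_)
  simp only [slope_def_module, hFTC]
  refine V.smul_mem _ (V.sub_mem (V.sub_mem (h _ ?_) (h _ hu)) (V.sub_mem (h _ ?_) (h _ hu)))
  · exact U.add_mem hu (U.smul_mem _ hv)
  · exact U.add_mem hu (U.smul_mem _ hv)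

/-- The linear span of the functions `f ∘ u`, `u ∈ U`. -/
def ridgeSpan (U : Submodule ℝ C(X, ℝ)) (f : C(ℝ, ℝ)) : Submodule ℝ C(X, ℝ) :=
  Submodule.span ℝ ((fun u => f.comp u) '' (U : Set C(X, ℝ)))

/-- Each directional derivative along some `v ∈ U` raises the order of the derivative of `g` by one
and contributes a factor `v`; iterating yields arbitrary products of elements of `U`. -/
theorem prod_mul_iteratedDeriv_mem {U V : Submodule ℝ C(X, ℝ)} (hV : IsClosed (V : Set C(X, ℝ)))
    {g : ℝ → ℝ} (hg : ContDiff ℝ ∞ g) (h : ∀ u ∈ U, (⟨g, hg.continuous⟩ : C(ℝ, ℝ)).comp u ∈ V)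
    (l : List C(X, ℝ)) (hl : ∀ v ∈ l, v ∈ U) {u : C(X, ℝ)} (hu : u ∈ U) :
    l.prod * (⟨iteratedDeriv l.length g,
      hg.continuous_iteratedDeriv _ (by exact_mod_cast le_top)⟩ : C(ℝ, ℝ)).comp u ∈ V := by
  induction l generalizing u with
  | nil => simpa using h u hu
  | cons v l ih =>
    have h1 := mul_comp_deriv_mem (g := ⟨iteratedDeriv l.length g, _⟩)
      (g' := ⟨iteratedDeriv (l.length + 1) g,
        hg.continuous_iteratedDeriv _ (by exact_mod_cast le_top)⟩) hV
      (fun x => by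
        have h2 : DifferentiableAt ℝ (iteratedDeriv l.length g) x :=
          (hg.differentiable_iteratedDeriv _ (by exact_mod_cast ENat.natCast_lt_top _)) x
        simpa [iteratedDeriv_succ] using h2.hasDerivAt)
      (fun u hu => ih (fun w hw => hl w (List.mem_cons_of_mem _ hw)) hu) hu
      (hl v List.mem_cons_self)
    rw [List.prod_cons, mul_comm v]
    exact h1

/-- `g.comp u` is the integral of `φ t • f.comp (u - t • 1)` in `C(X, ℝ)`. Since `U` contains the
constants, `u - t • 1` stays in `U`, so mollification does not leave the closed subspace. -/
theorem convolution_comp_mem {U V : Submodule ℝ C(X, ℝ)} (hV : IsClosed (V : Set C(X, ℝ)))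
    (hU : (1 : C(X, ℝ)) ∈ U) {f : C(ℝ, ℝ)} (h : ∀ u ∈ U, f.comp u ∈ V)
    {φ : ℝ → ℝ} (hφ : Continuous φ) (hφc : HasCompactSupport φ) {g : C(ℝ, ℝ)}
    (hg : ∀ x, g x = ∫ t, φ t * f (x - t)) {u : C(X, ℝ)} (hu : u ∈ U) : g.comp u ∈ V := by
  let Γ : C(ℝ, C(X, ℝ)) := ContinuousMap.curry
    ⟨fun z : ℝ × X => φ z.1 * f (u z.2 - z.1), by fun_prop⟩
  have hΓ : ∀ t, Γ t = φ t • f.comp (u - t • 1) := fun t => by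
    ext x
    simp [Γ]
  have hΓc : HasCompactSupport Γ := hφc.mono fun t ht h0 => ht (by rw [hΓ, h0, zero_smul])
  have h1 : ∫ t, Γ t ∈ V := integral_mem_of_isClosed hV Γ.continuous hΓc fun t => by
    rw [hΓ]
    exact V.smul_mem _ (h _ (U.sub_mem hu (U.smul_mem _ hU)))
  convert h1
  ext x
  have h2 := (ContinuousMap.evalCLM ℝ x).integral_comp_comm
    (Γ.continuous.integrable_of_hasCompactSupport (μ := volume) hΓc)
  change _ = (∫ t, Γ t) x at h2
  rw [← h2]
  exact hg _

/-- **Universal approximation.** If `f` is continuous and not a polynomial, then the compositions of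
`f` with a point-separating space of functions that contains the constants span a dense subspace. -/
theorem ridgeSpan_topologicalClosure_eq_top {U : Submodule ℝ C(X, ℝ)} (hU : (1 : C(X, ℝ)) ∈ U)
    (hsep : ∀ x y : X, x ≠ y → ∃ u ∈ U, u x ≠ u y) {f : C(ℝ, ℝ)}
    (hf : ¬ ∃ p : ℝ[X], ∀ t, f t = p.eval t) : (ridgeSpan U f).topologicalClosure = ⊤ := by
  set V := (ridgeSpan U f).topologicalClosure with hVdef
  have hV : IsClosed (V : Set C(X, ℝ)) := Submodule.isClosed_topologicalClosure _
  have hVf : ∀ u ∈ U, f.comp u ∈ V := fun u hu =>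
    Submodule.le_topologicalClosure _ (Submodule.subset_span ⟨u, hu, rfl⟩)
  let φ : ℕ → ContDiffBump (0 : ℝ) := fun i =>
    ⟨1 / (i + 1), 2 / (i + 1), by positivity, by gcongr; norm_num⟩
  let g : ℕ → ℝ → ℝ := fun i =>
    convolution ((φ i).normed volume) f (ContinuousLinearMap.lsmul ℝ ℝ) volume
  have hgdef : ∀ i x, g i x = ∫ t, (φ i).normed volume t * f (x - t) := fun i x => rfl
  have hgs : ∀ i, ContDiff ℝ ∞ (g i) := fun i =>
    ((φ i).hasCompactSupport_normed).contDiff_convolution_left _ (φ i).contDiff_normed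
      f.continuous.locallyIntegrable
  have hgf : ∀ x, Tendsto (fun i => g i x) atTop (𝓝 (f x)) := fun x =>
    ContDiffBump.convolution_tendsto_right_of_continuous
      (tendsto_const_div_atTop_nhds_zero_nat 2 |>.comp (tendsto_add_atTop_nat 1) |>.congr
        fun i => by simp [φ]) f.continuous x
  have hgV : ∀ i, ∀ u ∈ U, (⟨g i, (hgs i).continuous⟩ : C(ℝ, ℝ)).comp u ∈ V := fun i u hu =>
    convolution_comp_mem hV hU hVf (φ i).continuous_normed (φ i).hasCompactSupport_normed
      (hgdef i) hu
  -- The only use of non-polynomiality: if all `k`-th derivatives vanished, `f` would be a limit of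
  -- polynomials of degree below `k`.
  have hex : ∀ k : ℕ, ∃ i x, iteratedDeriv k (g i) x ≠ 0 := by
    intro k
    by_contra! hk
    exact hf (exists_polynomial_eq_of_tendsto k (fun i =>
      exists_polynomial_eq_of_iteratedDeriv_eq_zero k ((hgs i).of_le (by exact_mod_cast le_top)) (hk i)) hgf)
  have hprod : ∀ l : List C(X, ℝ), (∀ v ∈ l, v ∈ U) → l.prod ∈ V := by
    intro l hl
    obtain ⟨i, x, hx⟩ := hex l.length
    -- With `u` the constant function `x`, the derivative factor is a nonzero scalar and can be
    -- divided out.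
    have h1 := prod_mul_iteratedDeriv_mem hV (hgs i) (hgV i) l hl (U.smul_mem x hU)
    have h2 := V.smul_mem (iteratedDeriv l.length (g i) x)⁻¹ h1
    convert h2 using 1
    ext y
    simp
    field_simp
  let A : Subalgebra ℝ C(X, ℝ) := Algebra.adjoin ℝ (U : Set C(X, ℝ))
  have hAV : Subalgebra.toSubmodule A ≤ V := by
    rw [Algebra.adjoin_eq_span, Submodule.span_le]
    intro m hm
    obtain ⟨l, hl, rfl⟩ := Submonoid.exists_list_of_mem_closure hm
    exact hprod l hl
  have hA : A.topologicalClosure = ⊤ :=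
    ContinuousMap.subalgebra_topologicalClosure_eq_top_of_separatesPoints A fun x y hxy => by
      obtain ⟨u, hu, hne⟩ := hsep x y hxy
      exact ⟨u, ⟨u, Algebra.subset_adjoin hu, rfl⟩, hne⟩
  rw [eq_top_iff]
  intro m _
  have hm : m ∈ closure (A : Set C(X, ℝ)) := by
    have : m ∈ A.topologicalClosure := hA ▸ Algebra.mem_top
    exact this
  exact closure_minimal hAV hV hm

end UniversalApproximation

/-- The affine functions on a set of vectors. -/
def affineFun {ι : Type} [Fintype ι] (K : Set (ι → ℝ)) : ((ι → ℝ) × ℝ) →ₗ[ℝ] C(K, ℝ) where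
  toFun p := ⟨fun θ => p.1 ⬝ᵥ θ.1 + p.2, (continuous_const.dotProduct
    continuous_subtype_val).add continuous_const⟩
  map_add' p q := by
    ext θ
    simp [add_dotProduct]
    ring
  map_smul' r p := by
    ext θ
    simp [smul_dotProduct]
    ring

/-- One-hidden-layer perceptrons with a continuous non-polynomial activation approximate continuous
functions uniformly on compact sets. -/
theorem exists_mlp_approx {ι o : Type} [Fintype ι] [Fintype o] {K : Set (ι → ℝ)}
    (hK : IsCompact K) {act : ℝ → ℝ} (hact : Continuous act)
    (hpoly : ¬ ∃ p : Polynomial ℝ, ∀ t, act t = p.eval t) {F : (ι → ℝ) → o → ℝ}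
    (hF : ContinuousOn F K) {δ : ℝ} (hδ : 0 < δ) :
    ∃ (w : ℕ) (N : MLPParams ι o w), ∀ θ ∈ K, ∀ j, |F θ j - N.eval act θ j| ≤ δ := by
  classical
  have : CompactSpace K := isCompact_iff_compactSpace.1 hK
  let f : C(ℝ, ℝ) := ⟨act, hact⟩
  let U : Submodule ℝ C(K, ℝ) := LinearMap.range (affineFun K)
  have htop : (ridgeSpan U f).topologicalClosure = ⊤ := by
    refine ridgeSpan_topologicalClosure_eq_top (LinearMap.mem_range.2
      ⟨(0, 1), by ext; simp [affineFun]⟩) ?_ hpoly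
    intro x y hxy
    obtain ⟨i, hi⟩ := Function.ne_iff.1 (fun h => hxy (Subtype.ext h) : x.1 ≠ y.1)
    exact ⟨_, ⟨(Pi.single i 1, 0), rfl⟩, by simpa [affineFun] using hi⟩
  have hspan : ridgeSpan U f = Submodule.span ℝ (Set.range fun p => f.comp (affineFun K p)) := by
    rw [ridgeSpan]
    congr 1
    ext g
    simp [U]
  have happrox : ∀ j, ∃ c : ((ι → ℝ) × ℝ) →₀ ℝ, ∀ θ : K,
      |F θ j - c.sum fun p r => r * act (p.1 ⬝ᵥ θ.1 + p.2)| ≤ δ := by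
    intro j
    let G : C(K, ℝ) := ⟨fun θ => F θ j, (continuous_apply j).comp hF.domRestrict⟩
    have hG : G ∈ closure (ridgeSpan U f : Set C(K, ℝ)) := by
      have : G ∈ (ridgeSpan U f).topologicalClosure := htop ▸ Submodule.mem_top
      exact this
    obtain ⟨g, hg, hgd⟩ := Metric.mem_closure_iff.1 hG δ hδ
    rw [SetLike.mem_coe, hspan, Finsupp.mem_span_range_iff_exists_finsupp] at hg
    obtain ⟨c, rfl⟩ := hg
    refine ⟨c, fun θ => ?_⟩
    have h1 := (ContinuousMap.dist_apply_le_dist (f := G) θ).trans hgd.le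
    rw [Real.dist_eq] at h1
    have h2 : (c.sum fun p r => r • f.comp (affineFun K p)) θ =
        c.sum fun p r => r * act (p.1 ⬝ᵥ θ.1 + p.2) := by
      rw [Finsupp.sum, ContinuousMap.sum_apply]
      rfl
    rwa [h2] at h1
  choose c hc using happrox
  -- The output coordinates share one hidden layer: its neurons are all affine maps used for any
  -- coordinate, with output weight zero where unused.
  let S : Finset ((ι → ℝ) × ℝ) := Finset.univ.biUnion fun j => (c j).support
  let e := S.equivFin
  refine ⟨S.card, ⟨fun i => (e.symm i).1.1, fun i => (e.symm i).1.2,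
    fun j i => c j (e.symm i).1, 0⟩, fun θ hθ j => ?_⟩
  convert hc j ⟨θ, hθ⟩ using 3
  rw [Finsupp.sum_of_support_subset (s := S) _
    (Finset.subset_biUnion_of_mem (fun j => (c j).support) (Finset.mem_univ j)) _ (by simp),
    ← Finset.sum_coe_sort, ← e.symm.sum_comp]
  simp [MLPParams.eval, Matrix.mulVec, dotProduct]

/-! ### Richardson iteration -/

/-- Richardson iteration with step `η` for the linear system `A u = y`, started at `0`. -/
def richardson {n : ℕ} (A : Matrix (Fin n) (Fin n) ℝ) (η : ℝ) (y : Fin n → ℝ) : ℕ → Fin n → ℝ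
  | 0 => 0
  | l + 1 => richardson A η y l + η • (y - A *ᵥ richardson A η y l)

section Spectral

variable {n : ℕ} {A : Matrix (Fin n) (Fin n) ℝ}

theorem finite_spectrum (hA : A.IsHermitian) : (spectrum ℝ A).Finite := by
  rw [hA.spectrum_real_eq_range_eigenvalues]
  exact Set.finite_range _

theorem minEigenvalue_le (hA : A.IsHermitian) (i : Fin n) :
    minEigenvalue A ≤ hA.eigenvalues i :=
  csInf_le (finite_spectrum hA).bddBelow (hA.eigenvalues_mem_spectrum_real i)

theorem le_maxEigenvalue (hA : A.IsHermitian) (i : Fin n) :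
    hA.eigenvalues i ≤ maxEigenvalue A :=
  le_csSup (finite_spectrum hA).bddAbove (hA.eigenvalues_mem_spectrum_real i)

theorem minEigenvalue_le_maxEigenvalue (hA : A.IsHermitian) (hn : 1 ≤ n) :
    minEigenvalue A ≤ maxEigenvalue A :=
  (minEigenvalue_le hA ⟨0, hn⟩).trans (le_maxEigenvalue hA ⟨0, hn⟩)

theorem minEigenvalue_nonneg (hA : A.PosSemidef) : 0 ≤ minEigenvalue A := by
  refine Real.sInf_nonneg fun x hx => ?_
  rw [hA.1.spectrum_real_eq_range_eigenvalues] at hx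
  obtain ⟨i, rfl⟩ := hx
  exact hA.eigenvalues_nonneg i

theorem inner_eigenvectorBasis_mulVec (hA : A.IsHermitian) (i : Fin n) (v : Fin n → ℝ) :
    inner ℝ (hA.eigenvectorBasis i) (WithLp.toLp 2 (A *ᵥ v)) =
      hA.eigenvalues i * inner ℝ (hA.eigenvectorBasis i) (WithLp.toLp 2 v) := by
  have h1 : ∀ u : EuclideanSpace ℝ (Fin n), ∀ w : Fin n → ℝ,
      inner ℝ u (WithLp.toLp 2 w) = WithLp.ofLp u ⬝ᵥ w := fun u w => by
    simp [EuclideanSpace.inner_eq_star_dotProduct, dotProduct_comm]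
  have hT : Aᵀ = A := by simpa using hA.eq
  rw [h1, h1, Matrix.dotProduct_mulVec, ← Matrix.mulVec_transpose, hT,
    hA.mulVec_eigenvectorBasis, smul_dotProduct, smul_eq_mul]

/-- Error of the Richardson iteration for `(G + s) u = y` with positive semidefinite `G`, in the
direction `k`. -/
theorem abs_dotProduct_richardson_sub_le {G : Matrix (Fin n) (Fin n) ℝ} (hG : G.PosSemidef)
    {s η : ℝ} (hs : 0 < s) (hη : 0 < η) (hstep : η * (maxEigenvalue G + s) < 1)
    (k y : Fin n → ℝ) (l : ℕ) :
    |k ⬝ᵥ ((G + s • (1 : Matrix (Fin n) (Fin n) ℝ))⁻¹ *ᵥ y) -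
        k ⬝ᵥ richardson (G + s • (1 : Matrix (Fin n) (Fin n) ℝ)) η y l| ≤
      ‖WithLp.toLp 2 k‖ * ‖WithLp.toLp 2 y‖ / (minEigenvalue G + s) *
        (1 - η * (minEigenvalue G + s)) ^ l := by
  set A := G + s • (1 : Matrix (Fin n) (Fin n) ℝ) with hA
  set B := hG.1.eigenvectorBasis with hB
  set m := minEigenvalue G + s with hm
  have hm0 : 0 < m := by have := minEigenvalue_nonneg hG; positivity
  have hApd : A.PosDef := Matrix.PosDef.posSemidef_add hG (Matrix.PosDef.one.smul hs)
  have hAu : IsUnit A.det := (Matrix.isUnit_iff_isUnit_det A).1 hApd.isUnit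
  have hinner : ∀ i v, inner ℝ (B i) (WithLp.toLp 2 (A *ᵥ v)) =
      (hG.1.eigenvalues i + s) * inner ℝ (B i) (WithLp.toLp 2 v) := fun i v => by
    rw [hA, Matrix.add_mulVec, Matrix.smul_mulVec, Matrix.one_mulVec, WithLp.toLp_add,
      WithLp.toLp_smul, inner_add_right, inner_smul_right, inner_eigenvectorBasis_mulVec]
    ring
  set z := A⁻¹ *ᵥ y with hz
  have hAz : A *ᵥ z = y := by
    rw [hz, Matrix.mulVec_mulVec, Matrix.mul_nonsing_inv _ hAu, Matrix.one_mulVec]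
  -- The error obeys `e ↦ (1 - η A) e`, which is diagonal in the eigenbasis of `G`; the start at `0`
  -- makes the initial error `z`.
  have herr : ∀ l i, inner ℝ (B i) (WithLp.toLp 2 (z - richardson A η y l)) =
      (1 - η * (hG.1.eigenvalues i + s)) ^ l * inner ℝ (B i) (WithLp.toLp 2 z) := by
    intro l i
    induction l with
    | zero => simp [richardson]
    | succ l ih =>
      have h1 : z - richardson A η y (l + 1) =
          (z - richardson A η y l) - η • (A *ᵥ (z - richardson A η y l)) := by
        rw [Matrix.mulVec_sub, hAz, richardson]
        abel
      rw [h1, WithLp.toLp_sub, WithLp.toLp_smul, inner_sub_right, inner_smul_right, hinner, ih]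
      ring
  have hcoef : ∀ i, |inner ℝ (B i) (WithLp.toLp 2 (z - richardson A η y l))| ≤
      (1 - η * m) ^ l / m * |inner ℝ (B i) (WithLp.toLp 2 y)| := by
    intro i
    have h1 : m ≤ hG.1.eigenvalues i + s := by
      rw [hm]
      gcongr
      exact minEigenvalue_le hG.1 i
    have h2 : η * (hG.1.eigenvalues i + s) < 1 := by
      refine lt_of_le_of_lt ?_ hstep
      gcongr
      exact le_maxEigenvalue hG.1 i
    have h3 : η * m ≤ η * (hG.1.eigenvalues i + s) := by gcongr
    have h4 : (1 - η * (hG.1.eigenvalues i + s)) ^ l ≤ (1 - η * m) ^ l :=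
      pow_le_pow_left₀ (by linarith) (by linarith) l
    have h5 : 0 ≤ (1 - η * (hG.1.eigenvalues i + s)) ^ l := pow_nonneg (by linarith) l
    have h6 : 0 ≤ (1 - η * m) ^ l := h5.trans h4
    -- Replacing `y` by `A z` exposes the factor `λ_i + s ≥ m`, which pays for the division by `m`.
    rw [herr, ← hAz, hinner, abs_mul, abs_mul, abs_of_nonneg h5, abs_of_pos (hm0.trans_le h1),
      div_mul_eq_mul_div, le_div_iff₀ hm0]
    calc _ = (1 - η * (hG.1.eigenvalues i + s)) ^ l *
          (m * |inner ℝ (B i) (WithLp.toLp 2 z)|) := by ring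
      _ ≤ _ := by gcongr
  have hρ0 : 0 ≤ (1 - η * m) ^ l := by
    -- For `n = 0` the spectrum is empty and both extreme eigenvalues take the default value `0`, so
    -- the step-size hypothesis still applies.
    rcases isEmpty_or_nonempty (Fin n) with h | ⟨⟨i⟩⟩
    · have : spectrum ℝ G = ∅ := by
        rw [hG.1.spectrum_real_eq_range_eigenvalues, Set.range_eq_empty]
      have h1 : minEigenvalue G = maxEigenvalue G := by
        rw [minEigenvalue, maxEigenvalue, this, Real.sInf_empty, Real.sSup_empty]
      exact pow_nonneg (by rw [hm, h1]; linarith) l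
    · have := (minEigenvalue_le hG.1 i).trans (le_maxEigenvalue hG.1 i)
      have h1 : η * m ≤ η * (maxEigenvalue G + s) := by rw [hm]; gcongr
      exact pow_nonneg (by linarith) l
  have hnorm : ‖WithLp.toLp 2 (z - richardson A η y l)‖ ≤
      (1 - η * m) ^ l / m * ‖WithLp.toLp 2 y‖ := by
    refine le_of_sq_le_sq ?_ (by positivity)
    rw [mul_pow, ← B.sum_sq_norm_inner_right, ← B.sum_sq_norm_inner_right, Finset.mul_sum]
    refine Finset.sum_le_sum fun i _ => ?_
    rw [← mul_pow]
    exact pow_le_pow_left₀ (norm_nonneg _) (hcoef i) 2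
  rw [← dotProduct_sub]
  have h1 : k ⬝ᵥ (z - richardson A η y l) =
      inner ℝ (WithLp.toLp 2 k) (WithLp.toLp 2 (z - richardson A η y l)) := by
    simp [EuclideanSpace.inner_eq_star_dotProduct, dotProduct_comm]
  rw [h1]
  refine (abs_real_inner_le_norm _ _).trans ?_
  calc _ ≤ ‖WithLp.toLp 2 k‖ * ((1 - η * m) ^ l / m * ‖WithLp.toLp 2 y‖) := by gcongr
    _ = _ := by ring

end Spectral

/-! ### The tokens -/

theorem kvec_apply {d n : ℕ} (κ : (Fin d → ℝ) → (Fin d → ℝ) → ℝ) (Z : Context d n) (i : Fin n) :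
    kvec κ Z i = κ (Z.X i) Z.xq := rfl


/-- The input features of a token. -/
def Context.point {d n : ℕ} (Z : Context d n) : Col n → Fin d → ℝ := Sum.elim Z.X fun _ => Z.xq

@[simp] theorem Context.point_inl {d n : ℕ} (Z : Context d n) (i : Fin n) :
    Z.point (Sum.inl i) = Z.X i := rfl

@[simp] theorem Context.point_inr {d n : ℕ} (Z : Context d n) (u : Unit) :
    Z.point (Sum.inr u) = Z.xq := rfl

/-- The tokens after the first layer and `l` Richardson steps. -/
def richardsonTokens {d n : ℕ} (κ : (Fin d → ℝ) → (Fin d → ℝ) → ℝ) (σ η : ℝ) (Z : Context d n)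
    (l : ℕ) : Matrix (Row d) (Col n) ℝ :=
  Matrix.of fun r c => Sum.elim (Z.point c) ![inputTokens Z (Sum.inr 0) c, κ Z.xq (Z.point c),
    ∑ i, κ (Z.X i) (Z.point c) * richardson (labelCov κ σ Z.X) η Z.Y l i,
    ∑ i, κ (Z.X i) (Z.point c) * richardson (labelCov κ σ Z.X) η (kvec κ Z) l i] r

theorem featureProj_mulVec {d : ℕ} (v : Row d → ℝ) :
    (Matrix.fromBlocks 1 0 0 0 : Matrix (Row d) (Row d) ℝ) *ᵥ v = Sum.elim (v ∘ Sum.inl) 0 := by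
  rw [Matrix.fromBlocks_mulVec]
  simp

/-- Attention with a value matrix acting on the work rows. -/
theorem attn_apply {d n : ℕ} {κ : (Fin d → ℝ) → (Fin d → ℝ) → ℝ}
    {κTok : (Row d → ℝ) → (Row d → ℝ) → ℝ}
    (hext : ∀ x x' : Fin d → ℝ, κTok (Sum.elim x 0) (Sum.elim x' 0) = κ x x')
    (M : Matrix (Col n) (Col n) ℝ) (V : Matrix (Row d) (Row d) ℝ)
    {T : Matrix (Row d) (Col n) ℝ} {pt : Col n → Fin d → ℝ} (hT : ∀ k c, T (Sum.inl k) c = pt c k)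
    (r : Row d) (c : Col n) :
    attn κTok M V (Matrix.fromBlocks 1 0 0 0) (Matrix.fromBlocks 1 0 0 0) T r c =
      ∑ i, (V * T) r i * (κ (pt i) (pt c) * M i c) := by
  have h1 : ∀ c, (T.col c) ∘ Sum.inl = pt c := fun c => funext fun k => hT k c
  simp only [attn, Matrix.mul_apply (M := V * T), Matrix.of_apply, featureProj_mulVec, h1, hext]

/-- Only the query is attended to, and its label entry is `1`, so each token receives its kernel
value with the query. The last two registers are still zero, which matches the Richardson start: `L`
layers perform only `L - 1` steps. -/
theorem tokens_one {d n L : ℕ} {κ : (Fin d → ℝ) → (Fin d → ℝ) → ℝ}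
    {κTok : (Row d → ℝ) → (Row d → ℝ) → ℝ}
    (hext : ∀ x x' : Fin d → ℝ, κTok (Sum.elim x 0) (Sum.elim x' 0) = κ x x')
    (σ η : ℝ) (Z : Context d n) (hL : 0 < L) :
    tokens κTok (momentLayers d L σ η) Z 1 = richardsonTokens κ σ η Z 0 := by
  have hT : ∀ k c, inputTokens Z (Sum.inl k) c = Z.point c k := by
    rintro k (c | c) <;> rfl
  ext r c
  simp only [tokens, hL, dif_pos, if_true, Matrix.add_apply, momentLayers]
  rw [attn_apply hext _ _ hT]
  rcases r with k | s
  · simp [hT, richardsonTokens, Matrix.mul_apply]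
  · fin_cases s <;> rcases c with c | c <;>
    simp [richardsonTokens, Matrix.mul_apply, inputTokens, queryMask,
        Fin.sum_univ_four, richardson]

/-- At context token `i` a Richardson register holds `(G u)_i`, so the value matrix forms `η (y - G
u)_i` locally and attention spreads it with the kernel. The noise part `-η σ² u` needs no access to
`u`: by linearity it multiplies the register itself, which is the role of `S`. For the variance, the
register filled by the first layer serves as label, since by symmetry it holds `k_x` on the context.
-/
theorem tokens_succ {d n L : ℕ} {κ : (Fin d → ℝ) → (Fin d → ℝ) → ℝ}
    (hsymm : ∀ x x', κ x x' = κ x' x)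
    {κTok : (Row d → ℝ) → (Row d → ℝ) → ℝ}
    (hext : ∀ x x' : Fin d → ℝ, κTok (Sum.elim x 0) (Sum.elim x' 0) = κ x x')
    (σ η : ℝ) (Z : Context d n) (l : ℕ) (hL : l + 1 ≤ L) :
    tokens κTok (momentLayers d L σ η) Z (l + 1) = richardsonTokens κ σ η Z l := by
  induction l with
  | zero => exact tokens_one hext σ η Z hL
  | succ l ih =>
    specialize ih (by omega)
    have hT : ∀ k c, richardsonTokens κ σ η Z l (Sum.inl k) c = Z.point c k := fun k c => rfl
    have hstep : ∀ (y : Fin n → ℝ) (c : Col n),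
        ∑ i, κ (Z.X i) (Z.point c) * richardson (labelCov κ σ Z.X) η y (l + 1) i =
        ∑ i, κ (Z.X i) (Z.point c) * richardson (labelCov κ σ Z.X) η y l i +
        ∑ i, (η * y i - η * ∑ j, κ (Z.X j) (Z.X i) * richardson (labelCov κ σ Z.X) η y l j) *
          κ (Z.X i) (Z.point c) -
        η * σ ^ 2 * ∑ i, κ (Z.X i) (Z.point c) * richardson (labelCov κ σ Z.X) η y l i := by
      intro y c
      rw [Finset.mul_sum, ← Finset.sum_add_distrib, ← Finset.sum_sub_distrib]
      refine Finset.sum_congr rfl fun i _ => ?_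
      have h1 : ∀ u, (labelCov κ σ Z.X *ᵥ u) i =
          ∑ j, κ (Z.X j) (Z.X i) * u j + σ ^ 2 * u i := fun u => by
        rw [labelCov, Matrix.add_mulVec, Matrix.smul_mulVec, Matrix.one_mulVec]
        simp only [Pi.add_apply, Pi.smul_apply, smul_eq_mul, Matrix.mulVec, dotProduct, gram,
          Matrix.of_apply, hsymm (Z.X i)]
      simp only [richardson, Pi.add_apply, Pi.smul_apply, Pi.sub_apply, smul_eq_mul, h1]
      ring
    ext r c
    rw [tokens]
    simp only [ih, show l + 1 < L by omega, dif_pos, Nat.succ_ne_zero, if_false, Matrix.add_apply,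
      momentLayers]
    rw [attn_apply hext _ _ hT]
    rcases r with k | s
    · simp [richardsonTokens, Matrix.mul_apply]
    · fin_cases s
      · simp [richardsonTokens, Matrix.mul_apply, Fin.sum_univ_four]
      · simp [richardsonTokens, Matrix.mul_apply, Fin.sum_univ_four]
      · have := hstep Z.Y c
        simp [richardsonTokens, Matrix.mul_apply, contextMask, Fin.sum_univ_four, this,
          inputTokens]
        ring_nf
      · have := hstep (kvec κ Z) c
        simp [richardsonTokens, Matrix.mul_apply, contextMask, Fin.sum_univ_four, this,
          hsymm Z.xq (Z.X _), ← kvec_apply]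
        ring_nf

/-- The readout of the query token after `l` Richardson steps. -/
theorem momentReadout_mulVec_tokens {d n L : ℕ} {κ : (Fin d → ℝ) → (Fin d → ℝ) → ℝ}
    (hsymm : ∀ x x', κ x x' = κ x' x)
    {κTok : (Row d → ℝ) → (Row d → ℝ) → ℝ}
    (hext : ∀ x x' : Fin d → ℝ, κTok (Sum.elim x 0) (Sum.elim x' 0) = κ x x')
    (σ η : ℝ) (Z : Context d n) (l : ℕ) (hL : l + 1 ≤ L) :
    momentReadout d σ *ᵥ
        (tokens κTok (momentLayers d L σ η) Z (l + 1)).col (Sum.inr ()) =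
      ![kvec κ Z ⬝ᵥ richardson (labelCov κ σ Z.X) η Z.Y l,
        κ Z.xq Z.xq + σ ^ 2 - kvec κ Z ⬝ᵥ richardson (labelCov κ σ Z.X) η (kvec κ Z) l] := by
  rw [tokens_succ hsymm hext σ η Z l hL]
  ext i
  -- At the query the label entry `1` turns the weight `σ ^ 2` into the noise variance, and the
  -- first work register holds `κ(x, x)`.
  fin_cases i <;>
  simp [momentReadout, Matrix.mulVec, dotProduct, richardsonTokens, Fin.sum_univ_four, kvec,
    inputTokens]
  ring

/-! ### Total variation -/

section TotalVariation

open MeasureTheory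

variable {p q : ℝ → ℝ}

theorem tvDist_le_one (hp : Integrable p) (hq : Integrable q) (hp0 : ∀ y, 0 ≤ p y)
    (hq0 : ∀ y, 0 ≤ q y) (hp1 : ∫ y, p y = 1) (hq1 : ∫ y, q y = 1) : tvDist p q ≤ 1 := by
  have h : ∫ y, |p y - q y| ≤ ∫ y, (p y + q y) :=
    integral_mono (hp.sub hq).abs (hp.add hq) fun y =>
      abs_sub_le_iff.2 ⟨by linarith [hp0 y, hq0 y], by linarith [hp0 y, hq0 y]⟩
  rw [integral_add hp hq, hp1, hq1] at h
  rw [tvDist]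
  linarith

/-- A pointwise lower bound of `q` relative to `p` on `I` bounds the total variation distance. -/
theorem tvDist_le_of_exp_mul_le {I : Set ℝ} (hI : MeasurableSet I) (hp : Integrable p)
    (hq : Integrable q) (hp0 : ∀ y, 0 ≤ p y) (hq0 : ∀ y, 0 ≤ q y) (hp1 : ∫ y, p y = 1)
    (hq1 : ∫ y, q y = 1) {ε : ℝ} (hε : 0 ≤ ε) (h : ∀ y ∈ I, Real.exp (-ε) * p y ≤ q y) :
    tvDist p q ≤ (∫ y in Iᶜ, p y) + ε := by
  -- From `|x| = 2 x⁺ - x`: the positive part is at most the tail part plus `ε p`, by `1 - e^{-ε} ≤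
  -- ε`, and the signed part integrates to zero.
  have h1 : ∀ y, |p y - q y| ≤ 2 * (Iᶜ.indicator p y + ε * p y) - (p y - q y) := by
    intro y
    have h2 : p y - q y ≤ Iᶜ.indicator p y + ε * p y := by
      by_cases hy : y ∈ I
      · rw [Set.indicator_of_notMem (by simpa using hy)]
        have h3 := h y hy
        nlinarith [mul_le_mul_of_nonneg_right (Real.add_one_le_exp (-ε)) (hp0 y)]
      · rw [Set.indicator_of_mem (by simpa using hy)]
        nlinarith [hq0 y, mul_nonneg hε (hp0 y)]
    have h4 : 0 ≤ Iᶜ.indicator p y + ε * p y :=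
      add_nonneg (Set.indicator_nonneg (fun y _ => hp0 y) y) (mul_nonneg hε (hp0 y))
    exact abs_le.2 ⟨by linarith, by linarith⟩
  have hi : Integrable fun y => Iᶜ.indicator p y + ε * p y :=
    (hp.indicator hI.compl).add (hp.const_mul ε)
  have hpq : Integrable fun y => p y - q y := hp.sub hq
  have h5 := integral_mono hpq.abs ((hi.const_mul 2).sub hpq) h1
  simp only [Pi.sub_apply] at h5
  rw [integral_sub (hi.const_mul 2) hpq] at h5
  rw [integral_sub hp hq, hp1, hq1, integral_const_mul,
    integral_add (hp.indicator hI.compl) (hp.const_mul ε), integral_indicator hI.compl,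
    integral_const_mul, hp1] at h5
  rw [tvDist]
  linarith

/-! ### Binned densities and the normal distribution -/

variable {a b : ℝ} {C : ℕ}

theorem gridPoint_succ_sub (a b : ℝ) (C c : ℕ) :
    gridPoint a b C (c + 1) - gridPoint a b C c = (b - a) / C := by
  simp only [gridPoint]
  push_cast
  ring

theorem gridPoint_monotone (hab : a < b) (C : ℕ) : Monotone (gridPoint a b C) := by
  refine monotone_nat_of_le_succ fun c => ?_
  have h1 : 0 ≤ (b - a) / C := div_nonneg (by linarith) (Nat.cast_nonneg _)
  linarith [gridPoint_succ_sub a b C c]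

theorem gridPoint_zero : gridPoint a b C 0 = a := by simp [gridPoint]

theorem gridPoint_last (hC : 1 ≤ C) : gridPoint a b C C = b := by
  have : (C : ℝ) ≠ 0 := by positivity
  simp only [gridPoint]
  field_simp
  ring

theorem exists_mem_bin (hab : a < b) (hC : 1 ≤ C) {y : ℝ} (hy : y ∈ Set.Ioc a b) :
    ∃ c : Fin C, y ∈ Set.Ioc (gridPoint a b C c) (gridPoint a b C (c + 1)) := by
  have h := (gridPoint_monotone hab C).biUnion_Ico_Ioc_map_succ 0 C
  rw [gridPoint_zero, gridPoint_last hC] at h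
  rw [← h] at hy
  simp only [Set.mem_iUnion, exists_prop] at hy
  obtain ⟨c, hc, hyc⟩ := hy
  exact ⟨⟨c, hc.2⟩, hyc⟩

theorem bin_subset (hab : a < b) (hC : 1 ≤ C) (c : Fin C) :
    Set.Ioc (gridPoint a b C c) (gridPoint a b C (c + 1)) ⊆ Set.Ioc a b := by
  refine Set.Ioc_subset_Ioc ?_ ?_
  · simpa [gridPoint_zero] using gridPoint_monotone hab C (Nat.zero_le c)
  · simpa [gridPoint_last hC] using gridPoint_monotone hab C (Nat.succ_le_of_lt c.2)

theorem softmax_nonneg (ℓ : Fin C → ℝ) (c : Fin C) : 0 ≤ softmax ℓ c :=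
  div_nonneg (Real.exp_nonneg _) (Finset.sum_nonneg fun _ _ => Real.exp_nonneg _)

theorem sum_exp_pos (hC : 1 ≤ C) (ℓ : Fin C → ℝ) : 0 < ∑ c, Real.exp (ℓ c) :=
  Finset.sum_pos (fun _ _ => Real.exp_pos _) ⟨⟨0, hC⟩, Finset.mem_univ _⟩

theorem sum_softmax (hC : 1 ≤ C) (ℓ : Fin C → ℝ) : ∑ c, softmax ℓ c = 1 := by
  simp only [softmax, ← Finset.sum_div]
  exact div_self (sum_exp_pos hC ℓ).ne'

theorem binnedDensity_term_nonneg (hab : a < b) (ℓ : Fin C → ℝ) (y : ℝ) (c : Fin C) :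
    0 ≤ (Set.Ioc (gridPoint a b C c) (gridPoint a b C (c + 1))).indicator
      (fun _ => softmax ℓ c / (gridPoint a b C (c + 1) - gridPoint a b C c)) y := by
  refine Set.indicator_nonneg (fun _ _ => div_nonneg (softmax_nonneg ℓ c) ?_) y
  rw [gridPoint_succ_sub]
  exact div_nonneg (by linarith) (Nat.cast_nonneg _)

theorem binnedDensity_nonneg (hab : a < b) (ℓ : Fin C → ℝ) (y : ℝ) : 0 ≤ binnedDensity a b ℓ y :=
  Finset.sum_nonneg fun c _ => binnedDensity_term_nonneg hab ℓ y c

theorem integrable_binnedDensity_term (ℓ : Fin C → ℝ) (c : Fin C) :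
    Integrable ((Set.Ioc (gridPoint a b C c) (gridPoint a b C (c + 1))).indicator
      (fun _ => softmax ℓ c / (gridPoint a b C (c + 1) - gridPoint a b C c))) := by
  rw [integrable_indicator_iff measurableSet_Ioc]
  exact integrableOn_const (by simp)

theorem integrable_binnedDensity (ℓ : Fin C → ℝ) : Integrable (binnedDensity a b ℓ) :=
  integrable_finsetSum _ fun c _ => integrable_binnedDensity_term ℓ c

theorem integral_binnedDensity (hab : a < b) (hC : 1 ≤ C) (ℓ : Fin C → ℝ) :
    ∫ y, binnedDensity a b ℓ y = 1 := by
  simp only [binnedDensity]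
  rw [integral_finsetSum _ fun c _ => integrable_binnedDensity_term ℓ c, ← sum_softmax hC ℓ]
  refine Finset.sum_congr rfl fun c _ => ?_
  have hC0 : (0 : ℝ) < C := by exact_mod_cast hC
  have h1 : 0 < (b - a) / C := div_pos (by linarith) hC0
  rw [integral_indicator measurableSet_Ioc, setIntegral_const, gridPoint_succ_sub, measureReal_def,
    Real.volume_Ioc, gridPoint_succ_sub, ENNReal.toReal_ofReal h1.le, smul_eq_mul]
  exact mul_div_cancel₀ _ h1.ne'

/-- A binned density whose logits are close to an unnormalized log-density is bounded below by the
density. -/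
theorem exp_mul_le_binnedDensity (hab : a < b) (hC : 1 ≤ C) {ℓ : Fin C → ℝ} {s : ℝ → ℝ} {A ε : ℝ}
    (hA : 0 < A) (hps : ∀ y, p y = A * Real.exp (s y)) (hp : Integrable p) (hp1 : ∫ y, p y = 1)
    (h : ∀ c : Fin C, ∀ y ∈ Set.Ioc (gridPoint a b C c) (gridPoint a b C (c + 1)),
      |ℓ c - s y| ≤ ε) {y : ℝ} (hy : y ∈ Set.Ioc a b) :
    Real.exp (-(2 * ε)) * p y ≤ binnedDensity a b ℓ y := by
  have hC0 : (0 : ℝ) < C := by exact_mod_cast hC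
  set w := (b - a) / C with hw
  have hw0 : 0 < w := div_pos (by linarith) hC0
  have hp0 : ∀ y, 0 ≤ p y := fun y => by rw [hps]; positivity
  have hbin : ∀ c : Fin C, Real.exp (ℓ c) * w ≤ Real.exp ε / A *
      ∫ y in gridPoint a b C c..gridPoint a b C (c + 1), p y := by
    intro c
    rw [intervalIntegral.integral_of_le (gridPoint_monotone hab C (Nat.le_succ _)),
      ← integral_const_mul]
    have h1 : Real.exp (ℓ c) * w =
        ∫ _ in Set.Ioc (gridPoint a b C c) (gridPoint a b C (c + 1)), Real.exp (ℓ c) := by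
      rw [setIntegral_const, measureReal_def, Real.volume_Ioc, gridPoint_succ_sub,
        ENNReal.toReal_ofReal hw0.le, smul_eq_mul, mul_comm]
    rw [h1]
    refine setIntegral_mono_on (integrableOn_const (by simp)) (hp.integrableOn.const_mul _)
      measurableSet_Ioc fun y hy => ?_
    rw [hps, div_mul_eq_mul_div, le_div_iff₀ hA, mul_left_comm, ← Real.exp_add, mul_comm]
    have := (abs_le.1 (h c y hy)).2
    gcongr
    linarith
  -- The softmax normalizer is a Riemann sum for `∫ exp s` over `(a, b]`, at most `1 / A`. Only this
  -- upper bound is needed, so the mass of `p` on `(a, b]` may be arbitrarily small.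
  have hsum : (∑ c, Real.exp (ℓ c)) * w ≤ Real.exp ε / A := by
    rw [Finset.sum_mul]
    refine (Finset.sum_le_sum fun c _ => hbin c).trans ?_
    rw [← Finset.mul_sum, Fin.sum_univ_eq_sum_range
      (fun c => ∫ y in gridPoint a b C c..gridPoint a b C (c + 1), p y),
      intervalIntegral.sum_integral_adjacent_intervals fun c _ => hp.intervalIntegrable,
      gridPoint_zero, gridPoint_last hC, intervalIntegral.integral_of_le hab.le]
    have h2 := setIntegral_le_integral (s := Set.Ioc a b) hp (Filter.Eventually.of_forall hp0)
    rw [hp1] at h2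
    exact mul_le_of_le_one_right (by positivity) h2
  obtain ⟨c, hc⟩ := exists_mem_bin hab hC hy
  have h3 := Finset.single_le_sum (fun c _ => binnedDensity_term_nonneg hab ℓ y c)
    (Finset.mem_univ c)
  refine le_trans ?_ h3
  have hpos := sum_exp_pos hC ℓ
  rw [Set.indicator_of_mem hc, gridPoint_succ_sub, ← hw, softmax, div_div,
    le_div_iff₀ (by positivity)]
  calc Real.exp (-(2 * ε)) * p y * ((∑ c, Real.exp (ℓ c)) * w)
      ≤ Real.exp (-(2 * ε)) * p y * (Real.exp ε / A) := by
        have := hp0 y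
        gcongr
    _ = Real.exp (s y - ε) := by
        rw [hps, show s y - ε = -(2 * ε) + s y + ε by ring, Real.exp_add, Real.exp_add]
        field_simp
    _ ≤ Real.exp (ℓ c) := by
        have := (abs_le.1 (h c y hc)).1
        gcongr
        linarith

theorem abs_midpt_sub_le (c : Fin C) {y : ℝ}
    (hy : y ∈ Set.Ioc (gridPoint a b C c) (gridPoint a b C (c + 1))) :
    |midpt a b C c - y| ≤ (b - a) / C := by
  have h1 := gridPoint_succ_sub a b C c
  rw [midpt, abs_le]
  constructor <;> linarith [hy.1, hy.2]

/-- The moments enter the normal density through its natural parameter. -/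
theorem gaussianPDFReal_eq_exp {τ : ℝ} (hτ : 0 < τ) (μ y : ℝ) :
    ProbabilityTheory.gaussianPDFReal μ τ.toNNReal y =
      (Real.sqrt (2 * Real.pi * τ))⁻¹ * Real.exp (-μ ^ 2 / (2 * τ)) *
        Real.exp (μ / τ * y + -1 / (2 * τ) * y ^ 2) := by
  rw [ProbabilityTheory.gaussianPDFReal, Real.coe_toNNReal _ hτ.le, mul_assoc _ (Real.exp _), ← Real.exp_add]
  congr 2
  field_simp
  ring

/-- Total variation distance between a normal distribution and the binned density whose logits are
given by a perturbed natural parameter. -/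
theorem tvDist_gaussian_binnedDensity_le (hab : a < b) (hC : 1 ≤ C) {μ τ B R ε : ℝ} (hτ : 0 < τ)
    (ha : |a| ≤ B) (hb : |b| ≤ B) {θ : Fin 2 → ℝ}
    (h₁ : |μ / τ| ≤ R) (h₂ : |-1 / (2 * τ)| ≤ R)
    (hθ : ∀ j, |naturalParam ![μ, τ] j - θ j| ≤ ε) :
    tvDist (ProbabilityTheory.gaussianPDFReal μ τ.toNNReal)
        (binnedDensity a b (midptStats a b C *ᵥ θ)) ≤
      (∫ y in (Set.Ioc a b)ᶜ, ProbabilityTheory.gaussianPDFReal μ τ.toNNReal y) +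
        2 * ((B + B ^ 2) * ε + R * (1 + 2 * B) * ((b - a) / C)) := by
  have hτ' : τ.toNNReal ≠ 0 := by simpa using hτ
  have hB : 0 ≤ B := (abs_nonneg a).trans ha
  have hε : 0 ≤ ε := (abs_nonneg _).trans (hθ 0)
  have hR : 0 ≤ R := (abs_nonneg _).trans h₁
  have hw : 0 ≤ (b - a) / C := div_nonneg (by linarith) (Nat.cast_nonneg _)
  have hp := ProbabilityTheory.integrable_gaussianPDFReal μ τ.toNNReal
  have hp1 := ProbabilityTheory.integral_gaussianPDFReal_eq_one μ hτ'
  refine tvDist_le_of_exp_mul_le measurableSet_Ioc hp (integrable_binnedDensity _)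
    (ProbabilityTheory.gaussianPDFReal_nonneg _ _) (binnedDensity_nonneg hab _) hp1
    (integral_binnedDensity hab hC _) (by positivity) fun y hy =>
    exp_mul_le_binnedDensity hab hC (by positivity) (gaussianPDFReal_eq_exp hτ μ) hp hp1 ?_ hy
  intro c y hy
  have hbd : ∀ y ∈ Set.Icc a b, |y| ≤ B := fun y hy =>
    abs_le.2 ⟨by linarith [hy.1, (abs_le.1 ha).1], by linarith [hy.2, (abs_le.1 hb).2]⟩
  have hyB := hbd y (Set.Ioc_subset_Icc_self (bin_subset hab hC c hy))
  have hm := abs_midpt_sub_le c hy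
  set ξ := midpt a b C c with hξ
  have hξB : |ξ| ≤ B := by
    refine hbd ξ ?_
    have h3 : gridPoint a b C c < gridPoint a b C (c + 1) := hy.1.trans_le hy.2
    refine Set.Ioc_subset_Icc_self (bin_subset hab hC c ⟨?_, ?_⟩) <;> rw [hξ, midpt] <;> linarith
  have hθ0 := hθ 0
  have hθ1 := hθ 1
  simp only [naturalParam, Matrix.cons_val_zero, Matrix.cons_val_one] at hθ0 hθ1
  rw [abs_sub_comm] at hθ0 hθ1
  have hval : (midptStats a b C *ᵥ θ) c = ξ * θ 0 + ξ ^ 2 * θ 1 := by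
    simp [midptStats, Matrix.mulVec, dotProduct, Fin.sum_univ_two, hξ]
  rw [hval]
  -- Parameter error at the midpoint, plus the effect of moving from the midpoint to `y`.
  have hdecomp : ξ * θ 0 + ξ ^ 2 * θ 1 - (μ / τ * y + -1 / (2 * τ) * y ^ 2) =
      (ξ * (θ 0 - μ / τ) + ξ ^ 2 * (θ 1 - -1 / (2 * τ))) +
      (μ / τ * (ξ - y) + -1 / (2 * τ) * ((ξ + y) * (ξ - y))) := by ring
  rw [hdecomp]
  refine (abs_add_le _ _).trans (add_le_add ((abs_add_le _ _).trans ?_)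
    ((abs_add_le _ _).trans ?_))
  · rw [abs_mul, abs_mul, abs_pow, add_mul]
    gcongr
  · have h4 : |ξ + y| ≤ 2 * B := (abs_add_le _ _).trans (by linarith)
    rw [abs_mul, abs_mul, abs_mul (ξ + y)]
    calc _ ≤ R * ((b - a) / C) + R * (2 * B * ((b - a) / C)) := by gcongr
      _ = _ := by ring

end TotalVariation

/-! ### Approximation of the posterior predictive distribution -/

/-- Both differences are put over the product of the variances, at least `t ^ 2 / 2`. The weaker
bound on `θ'` allows for a perturbed point outside the compact set, and the splitting of the first
coordinate needs no bound on `θ' 0`. -/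
theorem naturalParam_lipschitz {R t E : ℝ} (ht : 0 < t) {θ θ' : Fin 2 → ℝ} (h0 : |θ 0| ≤ R)
    (h1 : t ≤ θ 1) (h1' : t / 2 ≤ θ' 1) (hE : ∀ j, |θ j - θ' j| ≤ E) (j : Fin 2) :
    |naturalParam θ j - naturalParam θ' j| ≤ (2 / t + (2 * R + 1) / t ^ 2) * E := by
  have hθ : 0 < θ 1 := ht.trans_le h1
  have hθ' : 0 < θ' 1 := (half_pos ht).trans_le h1'
  have hE0 : 0 ≤ E := (abs_nonneg _).trans (hE 0)
  have hR : 0 ≤ R := (abs_nonneg _).trans h0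
  have hprod : t ^ 2 / 2 ≤ θ 1 * θ' 1 :=
    calc t ^ 2 / 2 = t * (t / 2) := by ring
      _ ≤ _ := by gcongr
  have hE1 : |θ' 1 - θ 1| ≤ E := by rw [abs_sub_comm]; exact hE 1
  fin_cases j
  · have h2 : naturalParam θ 0 - naturalParam θ' 0 =
        (θ 0 - θ' 0) / θ' 1 + θ 0 * (θ' 1 - θ 1) / (θ 1 * θ' 1) := by
      simp only [naturalParam, Matrix.cons_val_zero]
      field_simp
      ring
    change |naturalParam θ 0 - naturalParam θ' 0| ≤ _
    rw [h2]
    refine (abs_add_le _ _).trans ?_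
    rw [abs_div, abs_div, abs_mul, abs_of_pos hθ', abs_of_pos (mul_pos hθ hθ')]
    calc _ ≤ E / (t / 2) + R * E / (t ^ 2 / 2) := by
          gcongr
          exact hE 0
      _ = (2 / t + 2 * R / t ^ 2) * E := by field_simp
      _ ≤ _ := by gcongr; linarith
  · have h2 : naturalParam θ 1 - naturalParam θ' 1 = (θ 1 - θ' 1) / (2 * (θ 1 * θ' 1)) := by
      simp only [naturalParam, Matrix.cons_val_one, Matrix.cons_val_fin_one]
      field_simp
      ring
    change |naturalParam θ 1 - naturalParam θ' 1| ≤ _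
    rw [h2, abs_div, abs_of_pos (mul_pos two_pos (mul_pos hθ hθ'))]
    calc _ ≤ E / (2 * (t ^ 2 / 2)) := by
          gcongr
          exact hE 1
      _ = (0 + 1 / t ^ 2) * E := by field_simp; ring
      _ ≤ _ := by
          gcongr
          · positivity
          · linarith

theorem MLPParams.sandwich_eval {ι ι' o o' : Type} [Fintype ι] [Fintype ι'] [Fintype o] {w : ℕ}
    (N : MLPParams ι o w) (W : Matrix ι ι' ℝ) (Ξ : Matrix o' o ℝ) (act : ℝ → ℝ) (x : ι' → ℝ) :
    (N.sandwich W Ξ).eval act x = Ξ *ᵥ N.eval act (W *ᵥ x) := by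
  simp [MLPParams.eval, MLPParams.sandwich, Matrix.mulVec_add, Matrix.mulVec_mulVec]

/-! ### Moment error after finitely many layers -/

section Convergence

variable {d n : ℕ} {κ : (Fin d → ℝ) → (Fin d → ℝ) → ℝ}

theorem gram_posSemidef (hκ : IsPSDKernel κ) {ι : Type*} (x : ι → Fin d → ℝ) :
    (gram κ x).PosSemidef :=
  Matrix.PosSemidef.submatrix hκ x

theorem convFactor_mem_Ioo (hκ : IsPSDKernel κ) {σ η : ℝ} (hσ : 0 < σ) (hη : 0 < η)
    (Z : Context d n) (hn : 1 ≤ n) (hstep : η * (maxEigenvalue (gram κ Z.X) + σ ^ 2) < 1) :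
    0 < convFactor κ σ η Z ∧ convFactor κ σ η Z < 1 := by
  have hG := gram_posSemidef hκ Z.X
  have h1 : η * (minEigenvalue (gram κ Z.X) + σ ^ 2) ≤
      η * (maxEigenvalue (gram κ Z.X) + σ ^ 2) := by
    gcongr
    exact minEigenvalue_le_maxEigenvalue hG.1 hn
  have h2 : 0 < η * (minEigenvalue (gram κ Z.X) + σ ^ 2) := by
    have := minEigenvalue_nonneg hG
    positivity
  rw [convFactor]
  constructor <;> linarith

/-- The moments read off after `l` Richardson steps. -/
theorem abs_moments_sub_le (hκ : IsPSDKernel κ) {σ η : ℝ} (hσ : 0 < σ) (hη : 0 < η)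
    (Z : Context d n) (hn : 1 ≤ n) (hstep : η * (maxEigenvalue (gram κ Z.X) + σ ^ 2) < 1) (l : ℕ)
    (j : Fin 2) :
    |moments κ σ Z j - ![kvec κ Z ⬝ᵥ richardson (labelCov κ σ Z.X) η Z.Y l,
        κ Z.xq Z.xq + σ ^ 2 - kvec κ Z ⬝ᵥ richardson (labelCov κ σ Z.X) η (kvec κ Z) l] j| ≤
      Real.exp 1 * (ratePrefactor κ σ Z *
        Real.exp (-((1 - convFactor κ σ η Z) * (l + 1 : ℕ)))) := by
  have hG := gram_posSemidef hκ Z.X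
  obtain ⟨hρ0, hρ1⟩ := convFactor_mem_Ioo hκ hσ hη Z hn hstep
  have hm : 0 < minEigenvalue (gram κ Z.X) + σ ^ 2 := by
    have := minEigenvalue_nonneg hG
    positivity
  set ρ := convFactor κ σ η Z with hρ
  -- The factor `e` compensates for the first layer, which is counted in the rate but performs no
  -- Richardson step.
  have hpow : ρ ^ l ≤ Real.exp 1 * Real.exp (-((1 - ρ) * (l + 1 : ℕ))) := by
    have h1 : ρ ^ l ≤ Real.exp (-(1 - ρ)) ^ l :=
      pow_le_pow_left₀ hρ0.le (by linarith [Real.add_one_le_exp (-(1 - ρ))]) l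
    refine h1.trans ?_
    rw [← Real.exp_nat_mul, ← Real.exp_add]
    gcongr
    push_cast
    linarith
  have hbound : ∀ y : Fin n → ℝ,
      ‖WithLp.toLp 2 y‖ ≤ max ‖WithLp.toLp 2 Z.Y‖ ‖WithLp.toLp 2 (kvec κ Z)‖ →
      |kvec κ Z ⬝ᵥ ((labelCov κ σ Z.X)⁻¹ *ᵥ y) -
        kvec κ Z ⬝ᵥ richardson (labelCov κ σ Z.X) η y l| ≤
      Real.exp 1 * (ratePrefactor κ σ Z * Real.exp (-((1 - ρ) * (l + 1 : ℕ)))) := by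
    intro y hy
    refine (abs_dotProduct_richardson_sub_le hG (by positivity) hη hstep _ y l).trans ?_
    rw [mul_left_comm, ratePrefactor]
    gcongr
    exact hpow
  fin_cases j
  · exact hbound Z.Y (le_max_left _ _)
  · have := hbound (kvec κ Z) (le_max_right _ _)
    rw [abs_sub_comm] at this
    convert this using 2
    simp only [moments, ppdVar, Fin.mk_one, Matrix.cons_val_one, Matrix.cons_val_fin_one]
    ring

end Convergence

end PFN

end

/-! ### Assembly of the error bound -/

theorem mainTheorem2 {d : ℕ}
    (κ : (Fin d → ℝ) → (Fin d → ℝ) → ℝ) (hκ : PFN.IsPSDKernel κ)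
    (κTok : (PFN.Row d → ℝ) → (PFN.Row d → ℝ) → ℝ) (hκTok : PFN.IsPSDKernel κTok)
    (hext : ∀ x x' : Fin d → ℝ, κTok (Sum.elim x 0) (Sum.elim x' 0) = κ x x')
    (σ : ℝ) (hσ : 0 < σ) (a b : ℝ) (hab : a < b)
    (K : Set (Fin 2 → ℝ)) (hK : IsCompact K) (hKpos : ∀ θ ∈ K, 0 < θ 1)
    (act : ℝ → ℝ) (hact : Continuous act)
    (hpoly : ¬ ∃ p : Polynomial ℝ, ∀ t, act t = p.eval t) :
    ∃ c : ℝ, 0 < c ∧ ∀ δ : ℝ, 0 < δ →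
      ∃ (w : ℕ) (N : PFN.MLPParams (Fin 2) (Fin 2) w),
        (∀ θ ∈ K, ‖WithLp.toLp 2 (PFN.naturalParam θ - N.eval act θ)‖ ≤ δ) ∧
        ∀ η : ℝ, 0 < η → ∀ L C : ℕ, 1 ≤ L → 1 ≤ C →
          ∃ ϑ : PFN.TransformerParams d L w C,
            ϑ.layers = PFN.momentLayers d L σ η ∧
            ϑ.head = N.sandwich (PFN.momentReadout d σ) (PFN.midptStats a b C) ∧
            ∀ (n : ℕ) (Z : PFN.Context d n), 1 ≤ n →
              PFN.moments κ σ Z ∈ K →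
              η * (PFN.maxEigenvalue (PFN.gram κ Z.X) + σ ^ 2) < 1 →
              0 < PFN.convFactor κ σ η Z ∧ PFN.convFactor κ σ η Z < 1 ∧
              PFN.tvDist (PFN.ppdDensity κ σ Z) (ϑ.density κTok act a b Z) ≤
                c * (PFN.ratePrefactor κ σ Z
                        * Real.exp (-((1 - PFN.convFactor κ σ η Z) * L))
                      + δ + 1 / C + PFN.tailMass κ σ Z a b) := by
  have hsymm : ∀ x x', κ x x' = κ x' x := fun x x' => by simpa using hκ.1.apply x' x
  obtain ⟨t, ht, htK⟩ := hK.exists_forall_le' (continuous_apply (1 : Fin 2)).continuousOn hKpos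
  obtain ⟨R, hR, hRK⟩ := hK.isBounded.exists_pos_norm_le
  have hRK' : ∀ θ ∈ K, ∀ j, |θ j| ≤ R := fun θ hθ j => (norm_le_pi_norm θ j).trans (hRK θ hθ)
  -- Moment errors up to `r` keep the variance above `t / 2` and the point inside the box `K'`. All
  -- constants below depend only on `K`, `a` and `b`.
  set r := min 1 (t / 2) with hr
  have hr0 : 0 < r := lt_min one_pos (half_pos ht)
  set B := max |a| |b| with hB
  have hB0 : 0 ≤ B := (abs_nonneg a).trans (le_max_left _ _)
  set Λ := 2 / t + (2 * R + 1) / t ^ 2 with hΛ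
  have hΛ0 : 0 ≤ Λ := by positivity
  set R' := R / t + 1 / (2 * t) with hR'
  have hR'0 : 0 ≤ R' := by positivity
  have hba : 0 ≤ b - a := by linarith
  set e := Real.exp 1 with he
  have he0 : 0 < e := Real.exp_pos 1
  set c₁ := e / r with hc₁
  set c₂ := 2 * (B + B ^ 2) * (Λ * e + 1) with hc₂
  set c₃ := 2 * (R' * (1 + 2 * B) * (b - a)) with hc₃
  have hc₁0 : 0 ≤ c₁ := by positivity
  have hc₂0 : 0 ≤ c₂ := by positivity
  have hc₃0 : 0 ≤ c₃ := by positivity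
  refine ⟨1 + c₁ + c₂ + c₃, by positivity, fun δ hδ => ?_⟩
  set K' : Set (Fin 2 → ℝ) := Set.Icc ![-(R + 1), t / 2] ![R + 1, R + 1] with hK'
  have hmem : ∀ θ ∈ K, ∀ θ' : Fin 2 → ℝ, (∀ j, |θ j - θ' j| ≤ r) → θ' ∈ K' := by
    intro θ hθ θ' h
    have h0 := abs_le.1 ((h 0).trans (min_le_left _ _))
    have h1 := abs_le.1 ((h 1).trans (min_le_left _ _))
    have h1' := abs_le.1 ((h 1).trans (min_le_right _ _))
    have hθ0 := abs_le.1 (hRK' θ hθ 0)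
    have hθ1 := abs_le.1 (hRK' θ hθ 1)
    have hθt := htK θ hθ
    rw [hK', Set.mem_Icc, Pi.le_def, Pi.le_def, Fin.forall_fin_two, Fin.forall_fin_two]
    simp only [Matrix.cons_val_zero, Matrix.cons_val_one, Matrix.cons_val_fin_one]
    exact ⟨⟨by linarith, by linarith⟩, by linarith, by linarith⟩
  have hK't : ∀ θ ∈ K', t / 2 ≤ θ 1 := fun θ hθ => hθ.1 1
  have hψ : ContinuousOn PFN.naturalParam K' := by
    refine continuousOn_pi.2 (Fin.forall_fin_two.2 ⟨?_, ?_⟩)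
    · exact ((continuous_apply 0).continuousOn).div (continuous_apply 1).continuousOn
        fun θ hθ => ((half_pos ht).trans_le (hK't θ hθ)).ne'
    · exact continuousOn_const.div (continuous_const.mul (continuous_apply 1)).continuousOn
        fun θ hθ => (mul_pos two_pos ((half_pos ht).trans_le (hK't θ hθ))).ne'
  -- Accuracy `δ / 2` in each of the two coordinates gives Euclidean accuracy `δ`; the approximation
  -- holds on all of `K'`, where the inexact readouts fall.
  obtain ⟨w, N, hN⟩ := PFN.exists_mlp_approx isCompact_Icc hact hpoly hψ (half_pos hδ)
  refine ⟨w, N, fun θ hθ => ?_, fun η hη L C hL hC =>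
    ⟨⟨PFN.momentLayers d L σ η, N.sandwich (PFN.momentReadout d σ) (PFN.midptStats a b C)⟩, rfl,
      rfl, fun n Z hn hZ hstep => ?_⟩⟩
  · have h1 := hN θ (hmem θ hθ θ fun j => by simpa using hr0.le)
    rw [EuclideanSpace.norm_eq, Real.sqrt_le_left hδ.le, Fin.sum_univ_two]
    have h2 := pow_le_pow_left₀ (abs_nonneg _) (h1 0) 2
    have h3 := pow_le_pow_left₀ (abs_nonneg _) (h1 1) 2
    simp only [Real.norm_eq_abs, Pi.sub_apply]
    nlinarith
  obtain ⟨hρ0, hρ1⟩ := PFN.convFactor_mem_Ioo hκ hσ hη Z hn hstep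
  refine ⟨hρ0, hρ1, ?_⟩
  obtain ⟨l, rfl⟩ : ∃ l, L = l + 1 := ⟨L - 1, by omega⟩
  obtain ⟨hτ, hppd⟩ := PFN.ppdDensity_eq hκ hσ Z
  have hlogits := PFN.MLPParams.sandwich_eval N (PFN.momentReadout d σ) (PFN.midptStats a b C) act
    ((PFN.tokens κTok (PFN.momentLayers d (l + 1) σ η) Z (l + 1)).col (Sum.inr ()))
  rw [PFN.momentReadout_mulVec_tokens hsymm hext σ η Z l le_rfl] at hlogits
  rw [PFN.TransformerParams.density, PFN.TransformerParams.logits, hlogits]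
  have herr := PFN.abs_moments_sub_le hκ hσ hη Z hn hstep l
  set θ' : Fin 2 → ℝ := ![PFN.kvec κ Z ⬝ᵥ PFN.richardson (PFN.labelCov κ σ Z.X) η Z.Y l,
    κ Z.xq Z.xq + σ ^ 2 -
      PFN.kvec κ Z ⬝ᵥ PFN.richardson (PFN.labelCov κ σ Z.X) η (PFN.kvec κ Z) l] with hθ'
  set Q := PFN.ratePrefactor κ σ Z *
    Real.exp (-((1 - PFN.convFactor κ σ η Z) * (l + 1 : ℕ))) with hQ
  have hQ0 : 0 ≤ Q := by
    have := (abs_nonneg _).trans (herr 0)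
    exact (mul_nonneg_iff_of_pos_left he0).1 this
  set T := PFN.tailMass κ σ Z a b with hT
  have hT' : T = ∫ y in (Set.Ioc a b)ᶜ, ProbabilityTheory.gaussianPDFReal (PFN.ppdMean κ σ Z)
      (PFN.ppdVar κ σ Z).toNNReal y := by
    rw [hT, PFN.tailMass, hppd]
  have hT0 : 0 ≤ T := by
    rw [hT']
    exact MeasureTheory.integral_nonneg (ProbabilityTheory.gaussianPDFReal_nonneg _ _)
  have hC0 : 0 ≤ 1 / (C : ℝ) := by positivity
  rw [hppd]
  -- If the moment error bound exceeds `r`, nothing is known about the perceptron's output, but then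
  -- `c₁ * Q ≥ 1` dominates any total variation distance.
  rcases le_or_gt (e * Q) r with hsmall | hlarge
  · have hθ'K : θ' ∈ K' := hmem _ hZ θ' fun j => (herr j).trans hsmall
    have hμ : |PFN.ppdMean κ σ Z| ≤ R := hRK' _ hZ 0
    have htτ : t ≤ PFN.ppdVar κ σ Z := htK _ hZ
    have hclose : ∀ j, |PFN.naturalParam (PFN.moments κ σ Z) j - N.eval act θ' j| ≤
        Λ * (e * Q) + δ := by
      intro j
      have h1 := PFN.naturalParam_lipschitz ht hμ htτ (hK't θ' hθ'K) herr j
      have h2 := hN θ' hθ'K j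
      have h3 := abs_sub_le (PFN.naturalParam (PFN.moments κ σ Z) j) (PFN.naturalParam θ' j)
        (N.eval act θ' j)
      linarith
    have h1 : |PFN.ppdMean κ σ Z / PFN.ppdVar κ σ Z| ≤ R' := by
      rw [abs_div, abs_of_pos hτ]
      calc _ ≤ R / t := by gcongr
        _ ≤ R' := le_add_of_nonneg_right (by positivity)
    have h2 : |-1 / (2 * PFN.ppdVar κ σ Z)| ≤ R' := by
      rw [abs_div, abs_neg, abs_one, abs_of_pos (by positivity)]
      calc _ ≤ 1 / (2 * t) := by gcongr
        _ ≤ R' := le_add_of_nonneg_left (by positivity)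
    refine (PFN.tvDist_gaussian_binnedDensity_le hab hC hτ (le_max_left _ _) (le_max_right _ _)
      h1 h2 hclose).trans ?_
    rw [← hT']
    have h3 : 2 * (B + B ^ 2) * (Λ * e) ≤ c₂ := by
      rw [hc₂]
      gcongr
      linarith
    have h4 : 2 * (B + B ^ 2) ≤ c₂ := by
      rw [hc₂]
      exact le_mul_of_one_le_right (by positivity) (by nlinarith [mul_nonneg hΛ0 he0.le])
    calc _ = 2 * (B + B ^ 2) * (Λ * e) * Q + 2 * (B + B ^ 2) * δ + c₃ * (1 / C) + 1 * T := by
          rw [hc₃]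
          ring
      _ ≤ (1 + c₁ + c₂ + c₃) * Q + (1 + c₁ + c₂ + c₃) * δ + (1 + c₁ + c₂ + c₃) * (1 / C) +
          (1 + c₁ + c₂ + c₃) * T := by
          gcongr <;> linarith
      _ = _ := by ring
  · have hτ' : (PFN.ppdVar κ σ Z).toNNReal ≠ 0 := by simpa using hτ
    refine (PFN.tvDist_le_one (ProbabilityTheory.integrable_gaussianPDFReal _ _)
      (PFN.integrable_binnedDensity _) (ProbabilityTheory.gaussianPDFReal_nonneg _ _)
      (PFN.binnedDensity_nonneg hab _)
      (ProbabilityTheory.integral_gaussianPDFReal_eq_one _ hτ')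
      (PFN.integral_binnedDensity hab hC _)).trans ?_
    have h1 : 1 ≤ c₁ * Q := by
      rw [hc₁, div_mul_eq_mul_div, le_div_iff₀ hr0]
      linarith
    calc (1 : ℝ) ≤ c₁ * Q := h1
      _ ≤ (1 + c₁ + c₂ + c₃) * (Q + δ + 1 / C + T) := by
          gcongr <;> linarith
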